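/- Consider the wave equation $\mathcal U\colon u_{tt}-u_{xx}=0$ for $u=u(t,x)$. Let $u_{ij}:=\partial^{i+j}u/\partial t^i\partial x^j$ be the jet variables, and let differential functions be the smooth real-valued functions of $t$, $x$ and finitely many $u_{ij}$, defined on the whole jet space, with total derivatives $\mathrm D_t,\mathrm D_x$. A differential function vanishes on solutions if it vanishes on the manifold in the jet space given by $u_{i+2,j}=u_{i,j+2}$, $i,j\ge0$. A conserved current is a pair $(P,Q)$ of differential functions such that $\mathrm D_tP+\mathrm D_xQ$ vanishes on solutions; it is trivial if it is the sum of a pair vanishing on solutions and of a pair whose total divergence vanishes identically; the space of conservation laws is the quotient of conserved currents by trivial ones. A conservation-law characteristic is a differential function $\mu$ such that $\mu(u_{tt}-u_{xx})$ is a total divergence $\mathrm D_tP+\mathrm D_xQ$. A variational symmetry is a differential function $\mu$ such that the prolongation $\sum_{i,j}(\mathrm D_t^i\mathrm D_x^j\mu)\,\partial_{u_{ij}}$ of $\mu\partial_u$ maps the Lagrangian density $-\frac12(u_t^2-u_x^2)$ to a total divergence. The corresponding quotient space is the quotient by those $\mu$ that vanish on solutions. Put $\eta:=x-t$, $\xi:=x+t$,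 $\check w_{0l}:=u_{0l}-u_{1,l-1}$ for $l\ge1$ and $\check w_{k0}:=u_{0k}+u_{1,k-1}$ for $k\ge1$. Let $\check F$ run through the smooth functions of $\eta$ and finitely many $\check w_{0l}$, let $\check G$ run through the smooth functions of $\xi$ and finitely many $\check w_{k0}$, and put $$\check{\mathscr D}_\eta:=\partial_\eta+\sum_{l\ge1}\check w_{0,l+1}\partial_{\check w_{0l}},\qquad \check{\mathscr D}_\xi:=\partial_\xi+\sum_{k\ge1}\check w_{k+1,0}\partial_{\check w_{k0}}.$$ **Theorem.** (1) All elements of $\check V:=\{(\check F-\check G,\check F+\check G)\}$ are conserved currents of $\mathcal U$, and the inclusion induces an isomorphism of $\check V/\check V_0$ onto the space of conservation laws of $\mathcal U$, where $\check V_0$ is the subspace of trivial conserved currents belonging to $\check V$. Moreover, $$\check V_0=\bigl\{\bigl(\check{\mathscr D}_\eta\check F-\check{\mathscr D}_\xi\check G+Cu_{01},\ \check{\mathscr D}_\eta\check F+\check{\mathscr D}_\xi\check G-Cu_{10}\bigr)\bigr\},$$ where $\check F$ and $\check G$ are as above and $C$ is an arbitrary real constant. (2) The variational symmetries of $\mathcal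 U$ are exactly its conservation-law characteristics. All functions of the form $$\mu=-\sum_{l\ge1}(-\check{\mathscr D}_\eta)^{l-1}\partial_{\check w_{0l}}\check F-\sum_{k\ge1}(-\check{\mathscr D}_\xi)^{k-1}\partial_{\check w_{k0}}\check G$$ are variational symmetries of $\mathcal U$, and the inclusion of the space of these functions induces an isomorphism of it onto the quotient space of variational symmetries of $\mathcal U$. For every $\check F$ and $\check G$, this $\mu$ is a characteristic of the conservation law containing $(\check F-\check G,\check F+\check G)$, that is, $\mu(u_{tt}-u_{xx})$ is the total divergence of a pair that differs from $(\check F-\check G,\check F+\check G)$ by a trivial conserved current. -/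

import Mathlib

open scoped ContDiff

noncomputable section

namespace WaveCL

/-! ### Smooth functions of finitely many of the coordinates of `ι → ℝ` -/

/-- The algebra of real functions on `ι → ℝ` that are smooth functions of finitely many of the
coordinates. -/
def smoothSubalgebra (ι : Type) : Subalgebra ℝ ((ι → ℝ) → ℝ) where
  carrier := {f | ∃ (S : Finset ι) (g : (S → ℝ) → ℝ),
    ContDiff ℝ ∞ g ∧ ∀ p : ι → ℝ, f p = g (fun i => p i)}
  algebraMap_mem' c := ⟨∅, fun _ => c, contDiff_const, fun _ => rfl⟩
  add_mem' := by
    classical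
    rintro f₁ f₂ ⟨S₁, g₁, h₁, e₁⟩ ⟨S₂, g₂, h₂, e₂⟩
    refine ⟨S₁ ∪ S₂, fun q => g₁ (fun i => q ⟨i, Finset.mem_union_left _ i.2⟩) +
      g₂ (fun i => q ⟨i, Finset.mem_union_right _ i.2⟩), ?_, fun p => ?_⟩
    · exact (h₁.comp (by fun_prop)).add (h₂.comp (by fun_prop))
    · simp [e₁, e₂]
  mul_mem' := by
    classical
    rintro f₁ f₂ ⟨S₁, g₁, h₁, e₁⟩ ⟨S₂, g₂, h₂, e₂⟩
    refine ⟨S₁ ∪ S₂, fun q => g₁ (fun i => q ⟨i, Finset.mem_union_left _ i.2⟩) *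
      g₂ (fun i => q ⟨i, Finset.mem_union_right _ i.2⟩), ?_, fun p => ?_⟩
    · exact (h₁.comp (by fun_prop)).mul (h₂.comp (by fun_prop))
    · simp [e₁, e₂]

/-- The type of the elements of `smoothSubalgebra ι`. -/
def SmoothFun (ι : Type) : Type := smoothSubalgebra ι

instance (ι : Type) : CommRing (SmoothFun ι) := inferInstanceAs (CommRing (smoothSubalgebra ι))

instance (ι : Type) : Algebra ℝ (SmoothFun ι) :=
  inferInstanceAs (Algebra ℝ (smoothSubalgebra ι))

/-- The `i`-th coordinate as a function. -/
def coord {ι : Type} (i : ι) : SmoothFun ι :=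
  ⟨fun p => p i, {i}, fun q => q ⟨i, Finset.mem_singleton_self i⟩, by fun_prop, fun _ => rfl⟩

section Derivatives

variable {ι : Type} [DecidableEq ι]

/-- The partial derivative of `f` with respect to the `i`-th coordinate. -/
def partialFun (i : ι) (f : (ι → ℝ) → ℝ) : (ι → ℝ) → ℝ :=
  fun p => deriv (fun s : ℝ => f (Function.update p i s)) (p i)

theorem partialFun_eq (i : ι) (S : Finset ι) (g : (S → ℝ) → ℝ) (hg : ContDiff ℝ ∞ g)
    (f : (ι → ℝ) → ℝ) (hf : ∀ p : ι → ℝ, f p = g (fun j => p j)) (p : ι → ℝ) :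
    HasDerivAt (fun s : ℝ => f (Function.update p i s))
      (fderiv ℝ g (fun j => p j) (fun j => if (j : ι) = i then 1 else 0)) (p i) := by
  have h1 : HasDerivAt (fun s : ℝ => (fun j : S => Function.update p i s j))
      (fun j : S => if (j : ι) = i then (1 : ℝ) else 0) (p i) := by
    rw [hasDerivAt_pi]
    intro j
    by_cases h : (j : ι) = i
    · simpa [Function.update_apply, h] using hasDerivAt_id' (p i)
    · simpa [Function.update_apply, h] using hasDerivAt_const (p i) (p j)
  have h2 : HasFDerivAt g (fderiv ℝ g (fun j => p j))
      ((fun s : ℝ => (fun j : S => Function.update p i s j)) (p i)) := by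
    simpa using (hg.differentiable (by simp) (fun j : S => p j)).hasFDerivAt
  have h3 := h2.comp_hasDerivAt (p i) h1
  have h4 : (fun s : ℝ => f (Function.update p i s)) =
      g ∘ (fun s : ℝ => (fun j : S => Function.update p i s j)) := by
    funext s
    simp [hf]
  rw [h4]
  exact h3

theorem partialFun_mem (i : ι) {f : (ι → ℝ) → ℝ} (hf : f ∈ smoothSubalgebra ι) :
    partialFun i f ∈ smoothSubalgebra ι := by
  obtain ⟨S, g, hg, e⟩ := hf
  refine ⟨S, fun q => fderiv ℝ g q (fun j => if (j : ι) = i then 1 else 0), ?_, fun p => ?_⟩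
  · exact (hg.fderiv_right (m := ∞) (by simp)).clm_apply contDiff_const
  · exact (partialFun_eq i S g hg f e p).deriv

theorem differentiableAt_update (i : ι) {f : (ι → ℝ) → ℝ} (hf : f ∈ smoothSubalgebra ι) (p : ι → ℝ) :
    DifferentiableAt ℝ (fun s : ℝ => f (Function.update p i s)) (p i) := by
  obtain ⟨S, g, hg, e⟩ := hf
  exact (partialFun_eq i S g hg f e p).differentiableAt

/-- The partial derivative with respect to the `i`-th coordinate as a linear operator. -/
def pd (i : ι) : SmoothFun ι →ₗ[ℝ] SmoothFun ι where
  toFun f := ⟨partialFun i f.1, partialFun_mem i f.2⟩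
  map_add' f g := by
    refine Subtype.ext (funext fun p => ?_)
    exact deriv_fun_add (differentiableAt_update i f.2 p) (differentiableAt_update i g.2 p)
  map_smul' c f := by
    refine Subtype.ext (funext fun p => ?_)
    exact deriv_const_mul c (differentiableAt_update i f.2 p)

theorem pd_support_finite (f : SmoothFun ι) : {i : ι | pd i f ≠ 0}.Finite := by
  obtain ⟨f, S, g, hg, e⟩ := f
  refine S.finite_toSet.subset fun i hi => ?_
  by_contra h
  refine hi (Subtype.ext (funext fun p => ?_))
  refine ((partialFun_eq i S g hg f e p).deriv).trans ?_
  have : (fun j : S => if (j : ι) = i then (1 : ℝ) else 0) = 0 := by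
    funext j
    have : (j : ι) ≠ i := fun hj => h (hj ▸ j.2)
    simp [this]
  rw [this, map_zero]
  rfl

theorem finsum_finite {T : ι → SmoothFun ι → SmoothFun ι} (hT : ∀ i, T i 0 = 0)
    (f : SmoothFun ι) : (Function.support fun i => T i (pd i f)).Finite := by
  refine (pd_support_finite f).subset fun i hi h => hi ?_
  simp [h, hT]

/-- The operator `f ↦ ∑ᵢ Tᵢ (∂ᵢ f)`; only finitely many terms are nonzero. -/
def sumPd (T : ι → SmoothFun ι →ₗ[ℝ] SmoothFun ι) : SmoothFun ι →ₗ[ℝ] SmoothFun ι where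
  toFun f := ∑ᶠ i, T i (pd i f)
  map_add' f g := by
    simp only [map_add]
    exact finsum_add_distrib (finsum_finite (T := fun i h => T i h) (by simp) f)
      (finsum_finite (T := fun i h => T i h) (by simp) g)
  map_smul' c f := by
    simp only [map_smul, RingHom.id_apply]
    exact (smul_finsum' c (finsum_finite (T := fun i h => T i h) (by simp) f)).symm

/-- The vector field `∑ᵢ Xᵢ ∂ᵢ` acting on functions. -/
def vectorField (X : ι → SmoothFun ι) : SmoothFun ι →ₗ[ℝ] SmoothFun ι :=
  sumPd fun i => LinearMap.mulLeft ℝ (X i)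

end Derivatives

/-- Substitution: `f ↦ f ∘ φ`, where the `k`-th argument of `f` is replaced by `φ k`. -/
def subst {κ ι : Type} (φ : κ → SmoothFun ι) : SmoothFun κ →ₗ[ℝ] SmoothFun ι where
  toFun f := ⟨fun p => f.1 (fun k => (φ k).1 p), by
    classical
    obtain ⟨f, S, g, hg, e⟩ := f
    choose T h hh eh using fun k => (φ k).2
    refine ⟨S.biUnion T, fun q => g (fun k => h k (fun i =>
      q ⟨i, Finset.mem_biUnion.2 ⟨k, k.2, i.2⟩⟩)), ?_, fun p => ?_⟩
    · exact hg.comp (contDiff_pi.2 fun k => (hh k).comp (by fun_prop))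
    · simp [e, eh]⟩
  map_add' _ _ := rfl
  map_smul' _ _ := rfl

/-! ### The jet space with coordinates `t, x, u_{ij} = ∂ₜⁱ ∂ₓʲ u` -/

/-- The names of the coordinates of the infinite jet space: `t`, `x` and `u i j` for `u_{ij}`. -/
inductive JetCoord : Type
  | t : JetCoord
  | x : JetCoord
  | u (i j : ℕ) : JetCoord
  deriving DecidableEq

/-- The algebra of differential functions of `u`. -/
abbrev DiffFun : Type := SmoothFun JetCoord

/-- The jet variable `u_{ij}`. -/
def u (i j : ℕ) : DiffFun := coord (JetCoord.u i j)

/-- The total derivative `D_t = ∂_t + ∑ u_{i+1,j} ∂_{u_{ij}}`. -/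
def Dt : DiffFun →ₗ[ℝ] DiffFun :=
  vectorField fun
    | .t => 1
    | .x => 0
    | .u i j => u (i + 1) j

/-- The total derivative `D_x = ∂_x + ∑ u_{i,j+1} ∂_{u_{ij}}`. -/
def Dx : DiffFun →ₗ[ℝ] DiffFun :=
  vectorField fun
    | .t => 0
    | .x => 1
    | .u i j => u i (j + 1)

/-- The total divergence `(P, Q) ↦ D_t P + D_x Q`. -/
def Div : DiffFun × DiffFun →ₗ[ℝ] DiffFun := Dt.coprod Dx

/-- The left hand side `u_tt - u_xx` of the wave equation. -/
def waveExpr : DiffFun := u 2 0 - u 0 2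

/-- The manifold in the jet space given by the wave equation and all its differential consequences
`D_tⁱ D_xʲ (u_tt - u_xx) = u_{i+2,j} - u_{i,j+2} = 0`. -/
def solutionManifold : Set (JetCoord → ℝ) :=
  {p | ∀ i j : ℕ, p (.u (i + 2) j) = p (.u i (j + 2))}

/-- The differential functions that vanish on solutions of the wave equation. -/
def VanishOnSol : Submodule ℝ DiffFun where
  carrier := {f | ∀ p ∈ solutionManifold, f.1 p = 0}
  zero_mem' := fun _ _ => rfl
  add_mem' := fun {f g} hf hg p hp => by
    change f.1 p + g.1 p = 0
    rw [hf p hp, hg p hp, add_zero]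
  smul_mem' := fun c f hf p hp => by
    change c * f.1 p = 0
    rw [hf p hp, mul_zero]

/-- The conserved currents of the wave equation: pairs whose total divergence vanishes on
solutions. -/
def ConservedCurrent : Submodule ℝ (DiffFun × DiffFun) := VanishOnSol.comap Div

/-- The trivial conserved currents: sums of a pair vanishing on solutions and of a null divergence
(a pair whose total divergence vanishes identically). -/
def TrivialCurrent : Submodule ℝ (DiffFun × DiffFun) :=
  VanishOnSol.prod VanishOnSol ⊔ LinearMap.ker Div

/-- The space of conservation laws: conserved currents modulo trivial ones. -/
abbrev ConservationLaw : Type :=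
  ConservedCurrent ⧸ TrivialCurrent.submoduleOf ConservedCurrent

/-- The conservation-law characteristics: `μ` such that `μ (u_tt - u_xx)` is a total divergence. -/
def Characteristic : Submodule ℝ DiffFun :=
  (LinearMap.range Div).comap (LinearMap.mulRight ℝ waveExpr)

/-- The Lagrangian density `-(u_t² - u_x²) / 2`. -/
def lagrangian : DiffFun := (-(1 / 2) : ℝ) • (u 1 0 ^ 2 - u 0 1 ^ 2)

/-- The prolongation `∑ (D_tⁱ D_xʲ μ) ∂_{u_{ij}}` of the evolutionary vector field `μ ∂_u`, applied
to `f`, as a linear function of `μ`. -/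
def prolong (f : DiffFun) : DiffFun →ₗ[ℝ] DiffFun where
  toFun μ := vectorField (fun
    | .t => 0
    | .x => 0
    | .u i j => (Dt ^ i) ((Dx ^ j) μ)) f
  map_add' μ ν := by
    refine (finsum_congr fun c => ?_).trans (finsum_add_distrib
      (finsum_finite (T := fun c g => LinearMap.mulLeft ℝ _ g) (by simp) f)
      (finsum_finite (T := fun c g => LinearMap.mulLeft ℝ _ g) (by simp) f))
    cases c <;> simp [add_mul]
  map_smul' c μ := by
    refine (finsum_congr fun k => ?_).trans (smul_finsum' c
      (finsum_finite (T := fun c g => LinearMap.mulLeft ℝ _ g) (by simp) f)).symm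
    cases k <;> simp

/-- The (characteristics `μ` of) variational symmetries `μ ∂_u` of the functional with density
`lagrangian`: the prolongation of `μ ∂_u` maps the density to a total divergence. -/
def VariationalSymmetry : Submodule ℝ DiffFun :=
  (LinearMap.range Div).comap (prolong lagrangian)

/-! ### Functions of a light-cone variable and of the corresponding derivatives -/

/-- Coordinates `z, v_0, v_1, …`. Functions of these are used as the functions of
`η, w_{01}, w_{02}, …` and as the functions of `ξ, w_{10}, w_{20}, …`; so `v l` stands for
`w_{0,l+1}` and `w_{l+1,0}`, respectively. -/
inductive LineCoord : Type
  | z : LineCoord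
  | v (l : ℕ) : LineCoord
  deriving DecidableEq

/-- Smooth functions of `z` and finitely many `v_l`. -/
abbrev LineFun : Type := SmoothFun LineCoord

/-- The operator `∂_z + ∑ v_{l+1} ∂_{v_l}`, i.e. `𝒟_η` and `𝒟_ξ`. -/
def lineD : LineFun →ₗ[ℝ] LineFun :=
  vectorField fun
    | .z => 1
    | .v l => coord (.v (l + 1))

/-- The operator `∑_{l ≥ 0} (-lineD)^l ∂_{v_l}`, i.e. `(-𝒟_η)^{l-1} ∂_{w_{0l}}` and
`(-𝒟_ξ)^{k-1} ∂_{w_{k0}}` summed over `l ≥ 1` and `k ≥ 1`. -/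
def lineEuler : LineFun →ₗ[ℝ] LineFun :=
  sumPd fun
    | .z => 0
    | .v l => (-lineD) ^ l

/-- `F ↦ F(x - t, w_{01}, w_{02}, …)` with `w_{0l} = u_{0l} - u_{1,l-1}`, `l ≥ 1`. -/
def evalEta : LineFun →ₗ[ℝ] DiffFun :=
  subst fun
    | .z => coord .x - coord .t
    | .v l => u 0 (l + 1) - u 1 l

/-- `G ↦ G(x + t, w_{10}, w_{20}, …)` with `w_{k0} = u_{0k} + u_{1,k-1}`, `k ≥ 1`. -/
def evalXi : LineFun →ₗ[ℝ] DiffFun :=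
  subst fun
    | .z => coord .x + coord .t
    | .v k => u 0 (k + 1) + u 1 k

/-- `(F, G) ↦ (F - G, F + G)`, with `F` a function of `η, w_{01}, …` and `G` a function of
`ξ, w_{10}, …`. -/
def current : LineFun × LineFun →ₗ[ℝ] DiffFun × DiffFun :=
  (evalEta.coprod (-evalXi)).prod (evalEta.coprod evalXi)

/-- The space of all pairs `(F - G, F + G)`. -/
def V : Submodule ℝ (DiffFun × DiffFun) := LinearMap.range current

/-- The trivial conserved currents belonging to `V`. -/
def V₀ : Submodule ℝ (DiffFun × DiffFun) := V ⊓ TrivialCurrent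

/-- `(F, G) ↦ μ = -(-𝒟_η)^{l-1} ∂_{w_{0l}} F - (-𝒟_ξ)^{k-1} ∂_{w_{k0}} G`, summed over
`l ≥ 1` and `k ≥ 1`. -/
def characteristicOf : LineFun × LineFun →ₗ[ℝ] DiffFun :=
  -((evalEta ∘ₗ lineEuler).coprod (evalXi ∘ₗ lineEuler))

/-- The space of all `μ` of this form. -/
def CharacteristicForm : Submodule ℝ DiffFun := LinearMap.range characteristicOf

end WaveCL

end

open scoped ContDiff

noncomputable section

namespace WaveCL

/-! ### Smoothness of integrals depending on parameters -/

section ParametricIntegral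

variable {E : Type} [NormedAddCommGroup E] [NormedSpace ℝ E] [FiniteDimensional ℝ E]

/-! The solution manifold has independent coordinates `η, ξ, u, a l, b k`, where `a l` and `b k`
stand for `2 ∂_η^(l+1) u` and `2 ∂_ξ^(k+1) u` and the mixed derivatives vanish. There `D_t = D_ξ -
D_η` and `D_x = D_ξ + D_η`, so `(P, Q)` is conserved iff `A = P + Q` and `B = Q - P`, restricted to
solutions, satisfy `D_ξ A + D_η B = 0`.

Surjectivity onto conservation laws (`exists_reduced_form`): differentiating this relation by the `b
k`, from the highest order down, shows that all `∂A/∂(b k)`, and then `∂A/∂u` and `∂A/∂ξ`, are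
`D_η`-exact. A scaling homotopy followed by a primitive in `u` gives `A = F(η, a) + D_η H`. Hence `B
+ D_ξ H` is annihilated by `D_η`, so it equals some `G(ξ, b)`. The terms with `H` form a null
divergence on solutions.

Characteristics (`exists_current_with_characteristic`): `D_t + D_x` kills `η` and sends each
`w_{0l}` to minus an `x`-derivative of the wave expression. Integration by parts turns the
divergence of the current into `μ (u_tt - u_xx)` plus `D_x` of a function vanishing on solutions.
The `ξ` side is similar.

Triviality (`mem_vanishOnSol_of_Div_eq`): a characteristic of a trivial current vanishes on
solutions. This is an Euler operator argument with derivatives transversal to the solution manifold.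
For a trivial current in `V` the Euler expressions of `F` and `G`, which depend on disjoint sets of
variables, therefore sum to zero. They are opposite constants, and the kernel of the Euler operator
on functions of `z, v_l` is the image of `lineD`. The constants produce the terms with `C`.

Part (2) follows, because the Euler-Lagrange expression of the Lagrangian is the wave expression,
and because a `μ` of the explicit form depends only on functions that remain independent on
solutions. -/

theorem hasFDerivAt_parametric_integral {F : Type} [NormedAddCommGroup F] [NormedSpace ℝ F]
    {h : E × ℝ → F} (hh : ContDiff ℝ 1 h) (x : E) :
    HasFDerivAt (fun y => ∫ s in (0 : ℝ)..1, h (y, s))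
      (∫ s in (0 : ℝ)..1, (fderiv ℝ h (x, s)).comp (ContinuousLinearMap.inl ℝ E ℝ)) x := by
  have hc : Continuous fun q : E × ℝ =>
      (fderiv ℝ h q).comp (ContinuousLinearMap.inl ℝ E ℝ) :=
    (hh.continuous_fderiv (by simp)).clm_comp continuous_const
  obtain ⟨C, hC⟩ := ((isCompact_closedBall x 1).prod
    (isCompact_Icc (a := (0 : ℝ)) (b := 1))).exists_bound_of_continuousOn hc.continuousOn
  refine intervalIntegral.hasFDerivAt_integral_of_dominated_of_fderiv_le (bound := fun _ => C)
    (F := fun (y : E) s => h (y, s))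
    (F' := fun (y : E) s => (fderiv ℝ h (y, s)).comp (ContinuousLinearMap.inl ℝ E ℝ))
    (Metric.ball_mem_nhds x one_pos) ?_ ?_ ?_ ?_ ?_ ?_
  · exact .of_forall fun y => (hh.continuous.comp (by fun_prop)).aestronglyMeasurable
  · exact (hh.continuous.comp (by fun_prop)).intervalIntegrable _ _
  · exact (hc.comp (by fun_prop : Continuous fun s : ℝ => (x, s))).aestronglyMeasurable
  · refine .of_forall fun s hs y hy => hC (y, s) ⟨Metric.ball_subset_closedBall hy, ?_⟩
    rw [Set.uIoc_of_le zero_le_one] at hs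
    exact ⟨hs.1.le, hs.2⟩
  · exact intervalIntegrable_const
  · refine .of_forall fun s _ y _ => ?_
    have h1 : HasFDerivAt h (fderiv ℝ h (y, s)) (y, s) :=
      (hh.differentiable (by simp) _).hasFDerivAt
    exact h1.comp y (hasFDerivAt_prodMk_left y s)

theorem contDiff_nat_parametric_integral (n : ℕ) :
    ∀ {F : Type} [NormedAddCommGroup F] [NormedSpace ℝ F] {h : E × ℝ → F},
      ContDiff ℝ n h → ContDiff ℝ n fun y => ∫ s in (0 : ℝ)..1, h (y, s) := by
  -- The target space stays quantified in the induction, because the derivative takes values in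
  -- another space.
  induction n with
  | zero =>
    intro F _ _ h hh
    have := hh.continuous
    exact contDiff_zero.2
      (intervalIntegral.continuous_parametric_intervalIntegral_of_continuous'
        (f := fun y s => h (y, s)) (by fun_prop) 0 1)
  | succ n ih =>
    intro F _ _ h hh
    have h1 : ContDiff ℝ 1 h := hh.of_le (by norm_cast; omega)
    refine (contDiff_succ_iff_hasFDerivAt (n := n)).2
      ⟨fun x => ∫ s in (0 : ℝ)..1, (fderiv ℝ h (x, s)).comp (ContinuousLinearMap.inl ℝ E ℝ),
        ih (h := fun q => (fderiv ℝ h q).comp (ContinuousLinearMap.inl ℝ E ℝ)) ?_,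
        hasFDerivAt_parametric_integral h1⟩
    exact (hh.fderiv_right (m := n) (by norm_cast)).clm_comp contDiff_const

theorem contDiff_parametric_integral {F : Type} [NormedAddCommGroup F] [NormedSpace ℝ F]
    {h : E × ℝ → F} (hh : ContDiff ℝ ∞ h) :
    ContDiff ℝ ∞ fun y => ∫ s in (0 : ℝ)..1, h (y, s) :=
  contDiff_infty.2 fun n => contDiff_nat_parametric_integral n (hh.of_le (by exact_mod_cast le_top))

end ParametricIntegral

/-! ### Calculus of smooth functions of finitely many coordinates -/

namespace SmoothFun

variable {ι : Type}

theorem ext {f g : SmoothFun ι} (h : ∀ p, f.1 p = g.1 p) : f = g :=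
  Subtype.ext (funext h)

/-- Evaluation at a point. -/
def eval (p : ι → ℝ) : SmoothFun ι →ₐ[ℝ] ℝ where
  toFun f := f.1 p
  map_one' := rfl
  map_mul' _ _ := rfl
  map_zero' := rfl
  map_add' _ _ := rfl
  commutes' _ := rfl

theorem ext_eval {f g : SmoothFun ι} (h : ∀ p, eval p f = eval p g) : f = g := ext h

@[simp] theorem eval_coord (p : ι → ℝ) (i : ι) : eval p (coord i) = p i := rfl

@[simp] theorem eval_subst {κ : Type} (φ : κ → SmoothFun ι) (p : ι → ℝ) (f : SmoothFun κ) :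
    eval p (subst φ f) = eval (fun k => eval p (φ k)) f := rfl

end SmoothFun

open SmoothFun

section Subst

variable {κ ι : Type} (φ : κ → SmoothFun ι)

@[simp] theorem subst_mul (f g : SmoothFun κ) : subst φ (f * g) = subst φ f * subst φ g := rfl

@[simp] theorem subst_one : subst φ 1 = 1 := rfl

@[simp] theorem subst_coord (k : κ) : subst φ (coord k) = φ k := rfl

@[simp] theorem subst_algebraMap (c : ℝ) :
    subst φ (algebraMap ℝ (SmoothFun κ) c) = algebraMap ℝ (SmoothFun ι) c := rfl

theorem subst_subst {γ : Type} (ψ : γ → SmoothFun κ) (f : SmoothFun γ) :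
    subst φ (subst ψ f) = subst (fun k => subst φ (ψ k)) f := rfl

@[simp] theorem subst_id (f : SmoothFun ι) : subst coord f = f := rfl

end Subst

section Calculus

variable {ι : Type} [DecidableEq ι]

theorem hasDerivAt_update (i : ι) (f : SmoothFun ι) (p : ι → ℝ) :
    HasDerivAt (fun s : ℝ => eval (Function.update p i s) f) (eval p (pd i f)) (p i) :=
  (differentiableAt_update i f.2 p).hasDerivAt

theorem eval_pd_eq {i : ι} {f : SmoothFun ι} {p : ι → ℝ} {d : ℝ}
    (h : HasDerivAt (fun s : ℝ => eval (Function.update p i s) f) d (p i)) :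
    eval p (pd i f) = d := h.deriv

@[simp] theorem pd_mul (i : ι) (f g : SmoothFun ι) :
    pd i (f * g) = pd i f * g + f * pd i g := by
  refine ext_eval fun p => eval_pd_eq ?_
  have := (hasDerivAt_update i f p).mul (hasDerivAt_update i g p)
  simp only [Function.update_eq_self] at this
  simp only [map_mul, map_add]
  exact this

@[simp] theorem pd_algebraMap (i : ι) (c : ℝ) : pd i (algebraMap ℝ (SmoothFun ι) c) = 0 :=
  ext_eval fun _ => eval_pd_eq (hasDerivAt_const _ c)

@[simp] theorem pd_one (i : ι) : pd i (1 : SmoothFun ι) = 0 := by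
  simpa using pd_algebraMap i 1

theorem pd_coord (i j : ι) : pd i (coord j : SmoothFun ι) = if j = i then 1 else 0 := by
  refine ext_eval fun p => eval_pd_eq ?_
  by_cases h : j = i
  · subst h; simpa using hasDerivAt_id' (p j)
  · simpa [h] using hasDerivAt_const (p i) (p j)

@[simp] theorem pd_coord_self (i : ι) : pd i (coord i : SmoothFun ι) = 1 := by simp [pd_coord]

theorem eval_pd_of_repr (f : SmoothFun ι) {S : Finset ι} {g : (S → ℝ) → ℝ}
    (hg : ContDiff ℝ ∞ g) (e : ∀ p : ι → ℝ, f.1 p = g fun i => p i) (i : ι) (p : ι → ℝ) :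
    eval p (pd i f) = fderiv ℝ g (fun j => p j) (fun j => if (j : ι) = i then 1 else 0) :=
  (partialFun_eq i S g hg f.1 e p).deriv

theorem pd_eq_zero_of_repr (f : SmoothFun ι) {S : Finset ι} {g : (S → ℝ) → ℝ}
    (hg : ContDiff ℝ ∞ g) (e : ∀ p : ι → ℝ, f.1 p = g fun i => p i) {i : ι} (hi : i ∉ S) :
    pd i f = 0 := by
  refine ext_eval fun p => ?_
  rw [eval_pd_of_repr f hg e]
  have : (fun j : S => if (j : ι) = i then (1 : ℝ) else 0) = 0 := by
    funext j
    have : (j : ι) ≠ i := fun hj => hi (hj ▸ j.2)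
    simp [this]
  rw [this, map_zero, map_zero]

theorem fderiv_eq_sum_pd (f : SmoothFun ι) {S : Finset ι} {g : (S → ℝ) → ℝ}
    (hg : ContDiff ℝ ∞ g) (e : ∀ p : ι → ℝ, f.1 p = g fun i => p i) (p v : ι → ℝ) :
    fderiv ℝ g (fun j => p j) (fun j => v j) = ∑ i ∈ S, eval p (pd i f) * v i := by
  have h : (fun j : S => v j) =
      ∑ i : S, v i • (fun j : S => if (j : ι) = i then (1 : ℝ) else 0) := by
    funext j
    simp [Finset.sum_apply]
  rw [h, map_sum, ← Finset.sum_coe_sort S]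
  refine Finset.sum_congr rfl fun i _ => ?_
  rw [map_smul, eval_pd_of_repr f hg e, smul_eq_mul, mul_comm]

/-- A finite set of coordinates that carries the first derivatives of `f`. -/
theorem exists_finset_hasDerivAt (f : SmoothFun ι) : ∃ S : Finset ι,
    (∀ i, i ∉ S → pd i f = 0) ∧ ∀ (c : ℝ → ι → ℝ) (v : ι → ℝ) (s : ℝ),
      (∀ i, HasDerivAt (fun r => c r i) (v i) s) →
      HasDerivAt (fun r => eval (c r) f) (∑ i ∈ S, eval (c s) (pd i f) * v i) s := by
  obtain ⟨S, g, hg, e⟩ := f.2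
  refine ⟨S, fun i hi => pd_eq_zero_of_repr f hg e hi, fun c v s hc => ?_⟩
  rw [← fderiv_eq_sum_pd f hg e]
  have h1 : HasDerivAt (fun r : ℝ => fun j : S => c r j) (fun j : S => v j) s :=
    hasDerivAt_pi.2 fun j => hc j
  have h2 : HasFDerivAt g (fderiv ℝ g fun j => c s j) (fun j : S => c s j) :=
    (hg.differentiable (by simp) _).hasFDerivAt
  have h3 := h2.comp_hasDerivAt s h1
  have h4 : (fun r => eval (c r) f) = g ∘ fun r : ℝ => fun j : S => c r j :=
    funext fun r => e (c r)
  rw [h4]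
  exact h3

theorem pd_comm (i j : ι) (f : SmoothFun ι) : pd i (pd j f) = pd j (pd i f) := by
  obtain ⟨S, g, hg, e⟩ := f.2
  have h2 : ∀ i j : ι, ∀ p, eval p (pd i (pd j f)) = fderiv ℝ (fderiv ℝ g) (fun k => p k)
      (fun k => if (k : ι) = i then 1 else 0) (fun k => if (k : ι) = j then 1 else 0) := by
    intro i j p
    have hd : ContDiff ℝ ∞ (fderiv ℝ g) := hg.fderiv_right (m := ∞) (by simp)
    have hg' : ContDiff ℝ ∞ fun q : S → ℝ =>
        fderiv ℝ g q (fun k => if (k : ι) = j then 1 else 0) := hd.clm_apply contDiff_const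
    rw [eval_pd_of_repr (pd j f) hg' (fun p => eval_pd_of_repr f hg e j p) i p]
    rw [fderiv_clm_apply (hd.differentiable (by simp) _) (differentiableAt_const _)]
    simp
  refine ext_eval fun p => ?_
  rw [h2, h2]
  have hs : IsSymmSndFDerivAt ℝ g (fun k => p k) :=
    hg.contDiffAt.isSymmSndFDerivAt (by
      rw [minSmoothness_of_isRCLikeNormedField]
      exact WithTop.coe_le_coe.2 (le_top : (2 : ℕ∞) ≤ ⊤))
  exact hs _ _

/-! ### Vector fields -/

theorem vectorField_apply (X : ι → SmoothFun ι) (f : SmoothFun ι) :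
    vectorField X f = ∑ᶠ i, X i * pd i f := rfl

theorem vectorField_eq_sum (X : ι → SmoothFun ι) {f : SmoothFun ι} {S : Finset ι}
    (hS : ∀ i, i ∉ S → pd i f = 0) : vectorField X f = ∑ i ∈ S, X i * pd i f := by
  rw [vectorField_apply]
  refine finsum_eq_sum_of_support_subset _ fun i hi => ?_
  by_contra h
  exact hi (by simp [hS i h])

theorem exists_finset_pd (f : SmoothFun ι) : ∃ S : Finset ι, ∀ i, i ∉ S → pd i f = 0 :=
  let ⟨S, h, _⟩ := exists_finset_hasDerivAt f
  ⟨S, h⟩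

theorem exists_finset_pd₂ (f g : SmoothFun ι) :
    ∃ S : Finset ι, (∀ i, i ∉ S → pd i f = 0) ∧ ∀ i, i ∉ S → pd i g = 0 := by
  obtain ⟨S, hS⟩ := exists_finset_pd f
  obtain ⟨T, hT⟩ := exists_finset_pd g
  exact ⟨S ∪ T, fun i hi => hS i fun h => hi (Finset.mem_union_left _ h),
    fun i hi => hT i fun h => hi (Finset.mem_union_right _ h)⟩

@[simp] theorem vectorField_mul (X : ι → SmoothFun ι) (f g : SmoothFun ι) :
    vectorField X (f * g) = vectorField X f * g + f * vectorField X g := by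
  obtain ⟨S, hf, hg⟩ := exists_finset_pd₂ f g
  rw [vectorField_eq_sum X hf, vectorField_eq_sum X hg, vectorField_eq_sum X (S := S)
    (f := f * g) (fun i hi => by simp [hf i hi, hg i hi]), Finset.sum_mul, Finset.mul_sum,
    ← Finset.sum_add_distrib]
  exact Finset.sum_congr rfl fun i _ => by rw [pd_mul]; ring

@[simp] theorem vectorField_coord (X : ι → SmoothFun ι) (i : ι) :
    vectorField X (coord i) = X i := by
  rw [vectorField_eq_sum X (S := {i}) fun j hj => by
    rw [pd_coord, if_neg (by simpa [eq_comm] using hj)]]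
  simp

@[simp] theorem vectorField_one (X : ι → SmoothFun ι) : vectorField X 1 = 0 := by
  simp [vectorField_apply]

theorem vectorField_single (i : ι) (f : SmoothFun ι) :
    vectorField (Pi.single i 1) f = pd i f := by
  rw [vectorField_apply, finsum_eq_single _ i fun j hj => by simp [hj]]
  simp

theorem vectorField_add_field (X Y : ι → SmoothFun ι) (f : SmoothFun ι) :
    vectorField (fun i => X i + Y i) f = vectorField X f + vectorField Y f := by
  obtain ⟨S, hS⟩ := exists_finset_pd f
  simp only [vectorField_eq_sum _ hS, add_mul, Finset.sum_add_distrib]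

theorem vectorField_vectorField (X Y : ι → SmoothFun ι) (f : SmoothFun ι) :
    vectorField X (vectorField Y f) = vectorField Y (vectorField X f) +
      vectorField (fun i => vectorField X (Y i) - vectorField Y (X i)) f := by
  obtain ⟨S, hS⟩ := exists_finset_pd f
  have h2 : ∀ i k, k ∉ S → pd k (pd i f) = 0 := fun i k hk => by rw [pd_comm, hS k hk, map_zero]
  simp only [vectorField_eq_sum _ hS, map_sum, vectorField_mul]
  simp only [vectorField_eq_sum _ (h2 _), sub_mul, Finset.sum_add_distrib,
    Finset.sum_sub_distrib, Finset.mul_sum]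
  have h3 : ∑ i ∈ S, ∑ k ∈ S, X i * (Y k * pd k (pd i f)) =
      ∑ i ∈ S, ∑ k ∈ S, Y i * (X k * pd k (pd i f)) := by
    rw [Finset.sum_comm]
    refine Finset.sum_congr rfl fun i _ => Finset.sum_congr rfl fun k _ => ?_
    rw [pd_comm i k]
    ring
  rw [h3]
  ring

theorem pd_vectorField (i : ι) (Y : ι → SmoothFun ι) (f : SmoothFun ι) :
    pd i (vectorField Y f) = vectorField Y (pd i f) + vectorField (fun k => pd i (Y k)) f := by
  have h : ∀ k, vectorField Y ((Pi.single i 1 : ι → SmoothFun ι) k) = 0 := fun k => by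
    by_cases hk : k = i
    · subst hk; simp
    · simp [hk]
  have := vectorField_vectorField (Pi.single i 1) Y f
  simpa only [vectorField_single, h, sub_zero] using this

theorem exists_finset_pd_subst {κ : Type} [DecidableEq κ] (f : SmoothFun κ) :
    ∃ S : Finset κ, (∀ k, k ∉ S → pd k f = 0) ∧ ∀ (φ : κ → SmoothFun ι) (i : ι),
      pd i (subst φ f) = ∑ k ∈ S, pd i (φ k) * subst φ (pd k f) := by
  obtain ⟨S, hS, h⟩ := exists_finset_hasDerivAt f
  refine ⟨S, hS, fun φ i => ext_eval fun p => eval_pd_eq ?_⟩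
  have := h (fun r k => eval (Function.update p i r) (φ k)) (fun k => eval p (pd i (φ k))) (p i)
    fun k => hasDerivAt_update i (φ k) p
  simpa only [map_sum, map_mul, eval_subst, Function.update_eq_self, mul_comm] using this

/-- The chain rule for vector fields. -/
theorem vectorField_subst {κ : Type} [DecidableEq κ] (f : SmoothFun κ) :
    ∃ S : Finset κ, (∀ k, k ∉ S → pd k f = 0) ∧ ∀ (φ : κ → SmoothFun ι) (Y : ι → SmoothFun ι),
      vectorField Y (subst φ f) = ∑ k ∈ S, vectorField Y (φ k) * subst φ (pd k f) := by
  classical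
  obtain ⟨S, hS, h⟩ := exists_finset_pd_subst (ι := ι) f
  refine ⟨S, hS, fun φ Y => ?_⟩
  choose T hT using fun k => exists_finset_pd (φ k)
  have hT' : ∀ k ∈ S, ∀ i, i ∉ S.biUnion T → pd i (φ k) = 0 := fun k hk i hi =>
    hT k i fun h => hi (Finset.mem_biUnion.2 ⟨k, hk, h⟩)
  rw [vectorField_eq_sum Y (S := S.biUnion T) fun i hi => by
    rw [h]; exact Finset.sum_eq_zero fun k hk => by rw [hT' k hk i hi, zero_mul]]
  have h1 : ∀ k ∈ S, vectorField Y (φ k) * subst φ (pd k f) =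
      (∑ i ∈ S.biUnion T, Y i * pd i (φ k)) * subst φ (pd k f) := fun k hk => by
    rw [vectorField_eq_sum Y (hT' k hk)]
  rw [Finset.sum_congr rfl h1]
  simp only [h, Finset.mul_sum, Finset.sum_mul]
  rw [Finset.sum_comm]
  exact Finset.sum_congr rfl fun k _ => Finset.sum_congr rfl fun i _ => by ring

/-- Related vector fields. -/
theorem vectorField_subst_of_related {κ : Type} [DecidableEq κ] {φ : κ → SmoothFun ι}
    {X : κ → SmoothFun κ} {Y : ι → SmoothFun ι}
    (h : ∀ k, vectorField Y (φ k) = subst φ (X k)) (f : SmoothFun κ) :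
    vectorField Y (subst φ f) = subst φ (vectorField X f) := by
  obtain ⟨S, hS, hf⟩ := vectorField_subst (ι := ι) f
  rw [hf, vectorField_eq_sum X hS, map_sum]
  exact Finset.sum_congr rfl fun k _ => by rw [h, subst_mul]

end Calculus

/-! ### Integration with respect to an additional coordinate -/

section Integral

variable {ι : Type}

theorem contDiff_eval {E : Type} [NormedAddCommGroup E] [NormedSpace ℝ E] (f : SmoothFun ι)
    {c : E → ι → ℝ} (hc : ∀ i, ContDiff ℝ ∞ fun y => c y i) :
    ContDiff ℝ ∞ fun y => eval (c y) f := by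
  obtain ⟨S, g, hg, e⟩ := f.2
  have : (fun y => eval (c y) f) = g ∘ fun y => fun i : S => c y i := funext fun y => e (c y)
  rw [this]
  exact hg.comp (contDiff_pi.2 fun i => hc i)

/-- The point of `Option ι → ℝ` with the coordinate `s` at `none`. -/
def optionPoint (s : ℝ) (p : ι → ℝ) : Option ι → ℝ := fun o => o.elim s p

theorem contDiff_optionPoint (p : ι → ℝ) (o : Option ι) :
    ContDiff ℝ ∞ fun s => optionPoint s p o := by
  cases o
  · exact contDiff_id
  · exact contDiff_const

theorem intervalIntegrable_optionPoint (f : SmoothFun (Option ι)) (p : ι → ℝ) :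
    IntervalIntegrable (fun s => eval (optionPoint s p) f) MeasureTheory.volume 0 1 :=
  (contDiff_eval f (contDiff_optionPoint p)).continuous.intervalIntegrable _ _

/-- The integral over the unit interval with respect to the coordinate `none`. -/
def integ : SmoothFun (Option ι) →ₗ[ℝ] SmoothFun ι where
  toFun f := ⟨fun p => ∫ s in (0 : ℝ)..1, eval (optionPoint s p) f, by
    obtain ⟨S, g, hg, e⟩ := f.2
    refine ⟨Finset.eraseNone S, fun q => ∫ s in (0 : ℝ)..1, g fun o : S =>
      match h : o.1 with
      | none => s
      | some i => q ⟨i, Finset.mem_eraseNone.2 (h ▸ o.2)⟩, ?_, fun p => ?_⟩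
    · refine contDiff_parametric_integral
        (h := fun x : (Finset.eraseNone S → ℝ) × ℝ => g fun o : S =>
        match h : o.1 with
        | none => x.2
        | some i => x.1 ⟨i, Finset.mem_eraseNone.2 (h ▸ o.2)⟩) (hg.comp (contDiff_pi.2 ?_))
      rintro ⟨_ | i, h⟩
      · exact contDiff_snd
      · exact (contDiff_apply ℝ ℝ _).comp contDiff_fst
    · refine intervalIntegral.integral_congr fun s _ => (e _).trans (congrArg g ?_)
      funext ⟨o, h⟩
      cases o <;> rfl⟩
  map_add' f g := by
    refine ext fun p => ?_
    change ∫ s in (0 : ℝ)..1, eval (optionPoint s p) (f + g) = _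
    simp only [map_add]
    exact intervalIntegral.integral_add (intervalIntegrable_optionPoint f p)
      (intervalIntegrable_optionPoint g p)
  map_smul' c f := by
    refine ext fun p => ?_
    change ∫ s in (0 : ℝ)..1, eval (optionPoint s p) (c • f) = _
    simp only [map_smul]
    exact intervalIntegral.integral_smul c _

theorem eval_integ (f : SmoothFun (Option ι)) (p : ι → ℝ) :
    eval p (integ f) = ∫ s in (0 : ℝ)..1, eval (optionPoint s p) f := rfl

/-- Functions on `ι → ℝ` as functions on `Option ι → ℝ`. -/
def liftOption : SmoothFun ι →ₗ[ℝ] SmoothFun (Option ι) := subst fun i => coord (some i)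

theorem integ_lift_mul (f : SmoothFun ι) (g : SmoothFun (Option ι)) :
    integ (liftOption f * g) = f * integ g := by
  refine ext_eval fun p => ?_
  rw [map_mul (eval p), eval_integ, eval_integ]
  simp only [map_mul]
  exact intervalIntegral.integral_const_mul (eval p f) _

/-- Substitution of the real number `c` for the coordinate `none`. -/
def substNone (c : ℝ) : SmoothFun (Option ι) →ₗ[ℝ] SmoothFun ι :=
  subst fun o => o.elim (algebraMap ℝ _ c) coord

variable [DecidableEq ι]

theorem integ_pd_none (f : SmoothFun (Option ι)) :
    integ (pd none f) = substNone 1 f - substNone 0 f := by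
  refine ext_eval fun p => ?_
  have h1 : ∀ c : ℝ, eval p (substNone c f) = eval (optionPoint c p) f := by
    intro c
    refine (eval_subst _ p f).trans (congrArg (fun q => eval q f) (funext fun o => ?_))
    cases o <;> rfl
  rw [map_sub, h1, h1, eval_integ]
  refine intervalIntegral.integral_eq_sub_of_hasDerivAt
    (f := fun s => eval (optionPoint s p) f) (fun s _ => ?_)
    (intervalIntegrable_optionPoint (pd none f) p)
  have h2 : ∀ r, Function.update (optionPoint s p) none r = optionPoint r p := fun r => by
    funext o
    cases o <;> simp [optionPoint]
  have h3 := hasDerivAt_update none f (optionPoint s p)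
  simp only [h2] at h3
  exact h3

theorem pd_integ (i : ι) (f : SmoothFun (Option ι)) :
    pd i (integ f) = integ (pd (some i) f) := by
  refine ext_eval fun p => eval_pd_eq ?_
  have h2 : ∀ r s, optionPoint s (Function.update p i r) =
      Function.update (optionPoint s p) (some i) r := fun r s => by
    funext o
    cases o with
    | none => simp [optionPoint]
    | some j => by_cases h : j = i <;> simp [optionPoint, h]
  have hh : ContDiff ℝ ∞ fun x : ℝ × ℝ =>
      eval (optionPoint x.2 (Function.update p i x.1)) f := by
    refine contDiff_eval f fun o => ?_
    cases o with
    | none => exact contDiff_snd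
    | some j =>
      by_cases h : j = i
      · subst h
        simpa [optionPoint] using contDiff_fst
      · simpa [optionPoint, h] using contDiff_const
  have h1 := (hasFDerivAt_parametric_integral (hh.of_le (by exact_mod_cast le_top))
    (p i)).hasDerivAt
  rw [ContinuousLinearMap.intervalIntegral_apply] at h1
  · refine h1.congr_deriv (Eq.symm ?_)
    rw [eval_integ]
    refine intervalIntegral.integral_congr fun s _ => ?_
    have h3 := hasDerivAt_update (some i) f (optionPoint s p)
    have h4 := ((hh.differentiable (by simp) (p i, s)).hasFDerivAt.comp_hasDerivAt (p i)
      ((hasDerivAt_id (p i)).prodMk (hasDerivAt_const (p i) s)))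
    simp only [← h2] at h3
    simpa using h3.unique h4
  · refine Continuous.intervalIntegrable ?_ _ _
    have := hh.continuous_fderiv (by simp)
    exact (this.comp (by fun_prop : Continuous fun s : ℝ => (p i, s))).clm_comp continuous_const

/-- A vector field on `ι → ℝ` as a vector field on `Option ι → ℝ`. -/
def liftField (Y : ι → SmoothFun ι) : Option ι → SmoothFun (Option ι) :=
  fun o => o.elim 0 fun i => liftOption (Y i)

theorem vectorField_integ (Y : ι → SmoothFun ι) (f : SmoothFun (Option ι)) :
    vectorField Y (integ f) = integ (vectorField (liftField Y) f) := by
  obtain ⟨S, hS⟩ := exists_finset_pd f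
  have h1 : ∀ i, i ∉ Finset.eraseNone S → pd (some i) f = 0 := fun i hi =>
    hS _ fun h => hi (Finset.mem_eraseNone.2 h)
  have h2 : ∀ o, o ∉ Finset.insertNone (Finset.eraseNone S) → pd o f = 0 := fun o ho => by
    cases o with
    | none => exact absurd (by simp) ho
    | some i => exact h1 i fun h => ho (by simpa using h)
  rw [vectorField_eq_sum Y (S := Finset.eraseNone S) fun i hi => by
    rw [pd_integ, h1 i hi, map_zero], vectorField_eq_sum _ h2, Finset.sum_insertNone, map_add,
    map_sum]
  simp [liftField, pd_integ, integ_lift_mul]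

/-! ### Scaling some of the coordinates -/

/-- The substitution that multiplies the coordinates satisfying `C` by the coordinate `none`. -/
def scaling (C : ι → Prop) [DecidablePred C] (i : ι) : SmoothFun (Option ι) :=
  if C i then coord none * coord (some i) else coord (some i)

/-- The substitution of zero for the coordinates satisfying `C`. -/
def zeroing (C : ι → Prop) [DecidablePred C] (i : ι) : SmoothFun ι :=
  if C i then 0 else coord i

variable (C : ι → Prop) [DecidablePred C]

omit [DecidableEq ι] in
theorem substNone_one_scaling (f : SmoothFun ι) : substNone 1 (subst (scaling C) f) = f := by
  rw [substNone, subst_subst]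
  conv_rhs => rw [← subst_id f]
  congr 2
  funext i
  by_cases h : C i <;> simp [scaling, h]

omit [DecidableEq ι] in
theorem substNone_zero_scaling (f : SmoothFun ι) :
    substNone 0 (subst (scaling C) f) = subst (zeroing C) f := by
  rw [substNone, subst_subst]
  congr 2
  funext i
  by_cases h : C i <;> simp [scaling, zeroing, h]

/-- The fundamental theorem of calculus along the path that scales the coordinates in `C` from `0`
to `1`; the scaling parameter is the coordinate `none`. -/
theorem sub_zeroing (f : SmoothFun ι) :
    f - subst (zeroing C) f = integ (pd none (subst (scaling C) f)) := by
  rw [integ_pd_none, substNone_one_scaling, substNone_zero_scaling]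

theorem pd_none_scaling (f : SmoothFun ι) : ∃ S : Finset ι, (∀ i, i ∉ S → pd i f = 0) ∧
    pd none (subst (scaling C) f) =
      ∑ i ∈ S, if C i then coord (some i) * subst (scaling C) (pd i f) else 0 := by
  obtain ⟨S, hS, h⟩ := exists_finset_pd_subst (ι := Option ι) f
  refine ⟨S, hS, (h _ _).trans (Finset.sum_congr rfl fun i _ => ?_)⟩
  by_cases hi : C i <;> simp [scaling, hi, pd_coord]

theorem subst_zeroing_eq_self {f : SmoothFun ι} (h : ∀ i, C i → pd i f = 0) :
    subst (zeroing C) f = f := by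
  obtain ⟨S, hS, h'⟩ := pd_none_scaling C f
  refine (sub_eq_zero.1 ?_).symm
  rw [sub_zeroing, h', Finset.sum_eq_zero, map_zero]
  intro i _
  split_ifs with hi
  · simp [h i hi]
  · rfl

/-- The homotopy argument: the lifted field has no component along the scaling parameter, so it
commutes with `integ`, and a potential of the derivative in the parameter integrates to a potential
of the difference. -/
theorem sub_zeroing_mem_range {Y : ι → SmoothFun ι}
    {f : SmoothFun ι}
    (h : pd none (subst (scaling C) f) ∈ LinearMap.range (vectorField (liftField Y))) :
    f - subst (zeroing C) f ∈ LinearMap.range (vectorField Y) := by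
  obtain ⟨g, hg⟩ := h
  exact ⟨integ g, by rw [vectorField_integ, hg, sub_zeroing]⟩

omit C [DecidablePred C] in
/-- Functions have primitives with respect to each coordinate. -/
theorem exists_primitive (c : ι) (f : SmoothFun ι) :
    ∃ H : SmoothFun ι, pd c H = f ∧ ∀ j, j ≠ c → pd j f = 0 → pd j H = 0 := by
  obtain ⟨S, hS, h⟩ := exists_finset_pd_subst (ι := Option ι) f
  set φ : ι → SmoothFun (Option ι) := scaling (· = c) with hφ
  -- The primitive is `c ∫₀¹ f(s c) ds`. As `c ∂_c` and `s ∂_s` agree on `f(s c)`, its derivative is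
  -- the integral of `∂_s (s f(s c))`.
  refine ⟨coord c * integ (subst φ f), ?_, fun j hj hf => ?_⟩
  · have h1 : coord (some c) * pd (some c) (subst φ f) = coord none * pd none (subst φ f) := by
      rw [h, h, Finset.mul_sum, Finset.mul_sum]
      refine Finset.sum_congr rfl fun k _ => ?_
      by_cases hk : k = c
      · simp only [hφ, scaling, hk, if_true, pd_mul, pd_coord]
        simp
        ring
      · simp [hφ, scaling, hk, pd_coord]
    have h2 : integ (pd none (coord none * subst φ f)) = f := by
      have h3 : ∀ r : ℝ, substNone r (coord none * subst φ f) =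
          algebraMap ℝ _ r * substNone r (subst φ f) := fun r => rfl
      rw [integ_pd_none, h3, h3, substNone_one_scaling]
      simp
    rw [pd_mul, pd_coord_self, one_mul, pd_integ, ← integ_lift_mul]
    conv_rhs => rw [← h2]
    rw [pd_mul, pd_coord_self, one_mul, map_add, ← h1]
    rfl
  · rw [pd_mul, pd_coord, if_neg (Ne.symm hj), zero_mul, zero_add, pd_integ, h,
      Finset.sum_eq_zero, map_zero, mul_zero]
    intro k _
    by_cases hk : k = j
    · rw [hk, hf, map_zero, mul_zero]
    · by_cases hk' : k = c <;> simp [hφ, scaling, hk, hk', Ne.symm hj, pd_coord]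

theorem pd_subst_zeroing_of_pos {j : ι} (hj : C j) (f : SmoothFun ι) :
    pd j (subst (zeroing C) f) = 0 := by
  obtain ⟨S, hS, h⟩ := exists_finset_pd_subst (ι := ι) f
  rw [h]
  refine Finset.sum_eq_zero fun k _ => ?_
  by_cases hk : C k
  · simp [zeroing, hk]
  · have : k ≠ j := fun e => hk (e ▸ hj)
    simp [zeroing, hk, pd_coord, this]

theorem pd_subst_zeroing_of_neg {j : ι} (hj : ¬ C j) (f : SmoothFun ι) :
    pd j (subst (zeroing C) f) = subst (zeroing C) (pd j f) := by
  simp only [← vectorField_single]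
  refine vectorField_subst_of_related (fun k => ?_) f
  rw [vectorField_single]
  by_cases hk : k = j
  · subst hk
    simp [zeroing, hj]
  · by_cases hk' : C k <;> simp [zeroing, hk, hk', pd_coord]

omit C [DecidablePred C] in
-- Descending induction on the order: beyond the highest `c k` on which `f` depends, the derivative
-- is zero and `h0` applies.
theorem forall_pd_of_step {c : ℕ → ι} (hc : Function.Injective c) {f : SmoothFun ι}
    {P : SmoothFun ι → Prop} (h0 : P 0) (hs : ∀ k, P (pd (c (k + 1)) f) → P (pd (c k) f)) (k : ℕ) :
    P (pd (c k) f) := by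
  obtain ⟨S, hS⟩ := exists_finset_pd f
  obtain ⟨n, hn⟩ := (S.finite_toSet.preimage hc.injOn).bddAbove
  have h1 : ∀ m, P (pd (c (n + 1 - m)) f) := fun m => by
    induction m with
    | zero =>
      have : c (n + 1) ∉ S := fun h => absurd (hn h) (by simp)
      rw [Nat.sub_zero, hS _ this]
      exact h0
    | succ m ih =>
      by_cases hm : m < n + 1
      · refine hs _ ?_
        rwa [show n + 1 - (m + 1) + 1 = n + 1 - m by omega]
      -- Truncated subtraction has already reached the index `0`, which no longer changes.
      · rwa [show n + 1 - (m + 1) = n + 1 - m by omega]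
  by_cases hk : k ≤ n + 1
  · have := h1 (n + 1 - k)
    rwa [Nat.sub_sub_self hk] at this
  · have : c k ∉ S := fun h => absurd (hn h) (by simp; omega)
    rw [hS _ this]
    exact h0

end Integral

/-! ### Integration by parts -/

/-- The `D`-stable ideal `I` records where the potential lies: `⊤` gives the plain statement, while
`VanishOnSol` makes the potential a trivial correction of a current. -/
theorem integration_by_parts {R : Type} [CommRing R] [Algebra ℝ R] (D : R →ₗ[ℝ] R)
    (hD : ∀ a b, D (a * b) = D a * b + a * D b) (I : Submodule ℝ R)
    (hI : ∀ a ∈ I, ∀ b, a * b ∈ I) (hDI : ∀ a ∈ I, D a ∈ I) (l : ℕ) :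
    ∀ a ∈ I, ∀ b, (D ^ l) a * b - a * ((-D) ^ l) b ∈ I.map D := by
  induction l with
  | zero => simp
  | succ l ih =>
    intro a ha b
    have h1 := ih (D a) (hDI a ha) b
    have h2 : D (a * ((-D) ^ l) b) ∈ I.map D := Submodule.mem_map_of_mem (hI a ha _)
    have h3 := add_mem h1 h2
    rw [hD] at h3
    rw [pow_succ, pow_succ', Module.End.mul_apply, Module.End.mul_apply, LinearMap.neg_apply]
    convert h3 using 1
    ring

theorem integration_by_parts_range {ι : Type} [DecidableEq ι] (X : ι → SmoothFun ι) (l : ℕ)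
    (a b : SmoothFun ι) : (vectorField X ^ l) a * b - a * ((-vectorField X) ^ l) b ∈
      LinearMap.range (vectorField X) := by
  rw [LinearMap.range_eq_map]
  exact integration_by_parts (vectorField X) (vectorField_mul X) ⊤ (fun _ _ _ => trivial)
    (fun _ _ => trivial) l a trivial b

/-! ### The kernel of the Euler operator -/

theorem sumPd_eq_sum {ι : Type} [DecidableEq ι] (T : ι → SmoothFun ι →ₗ[ℝ] SmoothFun ι)
    {f : SmoothFun ι} {S : Finset ι} (hS : ∀ i, i ∉ S → pd i f = 0) :
    sumPd T f = ∑ i ∈ S, T i (pd i f) := by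
  change ∑ᶠ i, T i (pd i f) = _
  refine finsum_eq_sum_of_support_subset _ fun i hi => ?_
  by_contra h
  exact hi (by simp [hS i h])

/-- The coefficients of `lineD`. -/
def lineField : LineCoord → LineFun
  | .z => 1
  | .v l => coord (.v (l + 1))

theorem lineD_eq : lineD = vectorField lineField := by
  refine congrArg _ (funext fun c => ?_)
  cases c <;> rfl

/-- The coefficients of `lineEuler`. -/
def eulerCoeff : LineCoord → LineFun →ₗ[ℝ] LineFun
  | .z => 0
  | .v l => (-lineD) ^ l

theorem lineEuler_eq : lineEuler = sumPd eulerCoeff := by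
  refine congrArg _ (funext fun c => ?_)
  cases c <;> rfl

theorem pow_apply_of_intertwine {M N : Type} [AddCommGroup M] [AddCommGroup N] [Module ℝ M]
    [Module ℝ N] {f : M →ₗ[ℝ] N} {S : M →ₗ[ℝ] M} {T : N →ₗ[ℝ] N} (h : ∀ a, T (f a) = f (S a))
    (n : ℕ) (a : M) : (T ^ n) (f a) = f ((S ^ n) a) := by
  induction n generalizing a with
  | zero => rfl
  | succ n ih => rw [pow_succ, pow_succ, Module.End.mul_apply, Module.End.mul_apply, h, ih]

theorem lineField_scaling (c : LineCoord) :
    vectorField (liftField lineField) (scaling (· ≠ LineCoord.z) c) =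
      subst (scaling (· ≠ LineCoord.z)) (lineField c) := by
  cases c with
  | z => simp [scaling, lineField, liftField, liftOption]
  | v l => simp [scaling, lineField, liftField, liftOption]

theorem lineField_pow_coord (l : ℕ) :
    (vectorField (liftField lineField) ^ l) (coord (some (LineCoord.v 0))) =
      coord (some (LineCoord.v l)) := by
  induction l with
  | zero => rfl
  | succ l ih =>
    rw [pow_succ', Module.End.mul_apply, ih]
    simp [liftField, liftOption, lineField]

/-- The derivative of `F(z, s v)` in `s` is `∑ v_l (∂_{v_l} F)(z, s v)` with `v_l = D^l v_0`.
Integration by parts turns it into `v_0` times the scaled Euler expression, which is zero, modulo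
the image of `D`. -/
theorem sub_zeroing_mem_range_lineD {F : LineFun} (hF : lineEuler F = 0) :
    F - subst (zeroing (· ≠ LineCoord.z)) F ∈ LinearMap.range lineD := by
  rw [lineD_eq]
  apply sub_zeroing_mem_range
  obtain ⟨S, hS, h⟩ := pd_none_scaling (· ≠ LineCoord.z) F
  rw [h]
  set D := vectorField (liftField lineField) with hD
  have h1 : ∀ g, D (subst (scaling (· ≠ LineCoord.z)) g) =
      subst (scaling (· ≠ LineCoord.z)) (lineD g) := fun g => by
    rw [lineD_eq]
    exact vectorField_subst_of_related lineField_scaling g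
  have h2 : ∑ c ∈ S, coord (some (LineCoord.v 0)) * subst (scaling (· ≠ LineCoord.z))
      (eulerCoeff c (pd c F)) = 0 := by
    rw [← Finset.mul_sum, ← map_sum, ← sumPd_eq_sum _ hS, ← lineEuler_eq, hF, map_zero, mul_zero]
  rw [← Submodule.sub_mem_iff_left _ (h2 ▸ zero_mem _), ← Finset.sum_sub_distrib]
  refine sum_mem fun c _ => ?_
  cases c with
  | z => simp [eulerCoeff]
  | v l =>
    rw [if_pos (by simp), ← lineField_pow_coord l]
    simp only [eulerCoeff]
    rw [← pow_apply_of_intertwine (T := -D) (fun a => by simp [h1])]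
    exact integration_by_parts_range _ l _ _

theorem exists_lineD_eq_of_lineEuler_eq_zero {F : LineFun} (hF : lineEuler F = 0) :
    ∃ f, lineD f = F := by
  obtain ⟨f, hf⟩ := sub_zeroing_mem_range_lineD hF
  -- The remaining term depends on `z` only, and on such functions `lineD` is `∂_z`.
  obtain ⟨H, hH, hH'⟩ := exists_primitive LineCoord.z (subst (zeroing (· ≠ LineCoord.z)) F)
  refine ⟨f + H, ?_⟩
  have h1 : lineD H = subst (zeroing (· ≠ LineCoord.z)) F := by
    rw [lineD_eq, vectorField_eq_sum _ (S := {LineCoord.z})]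
    · simp [lineField, hH]
    · intro c hc
      have hc' : c ≠ LineCoord.z := by simpa using hc
      exact hH' c hc' (pd_subst_zeroing_of_pos (· ≠ LineCoord.z) hc' F)
  rw [map_add, hf, h1]
  abel

theorem lineEuler_v_zero : lineEuler (coord (.v 0)) = 1 := by
  rw [lineEuler_eq, sumPd_eq_sum _ (S := {LineCoord.v 0})]
  · simp [eulerCoeff]
  · intro c hc
    rw [pd_coord, if_neg (by simpa [eq_comm] using hc)]

theorem exists_lineD_add_of_lineEuler_eq_const {F : LineFun} {r : ℝ}
    (hF : lineEuler F = algebraMap ℝ _ r) : ∃ f, F = lineD f + r • coord (.v 0) := by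
  obtain ⟨f, hf⟩ := exists_lineD_eq_of_lineEuler_eq_zero (F := F - r • coord (.v 0)) (by
    rw [map_sub, map_smul, hF, lineEuler_v_zero, Algebra.algebraMap_eq_smul_one, sub_self])
  exact ⟨f, by rw [hf, sub_add_cancel]⟩

/-! ### The reduced jet space -/

/-- Coordinates on the solution manifold: the light-cone variables `η` and `ξ`, the dependent
variable and its derivatives, `a l` for `w_{0,l+1}` and `b k` for `w_{k+1,0}`. -/
inductive RedCoord : Type
  | eta : RedCoord
  | xi : RedCoord
  | u : RedCoord
  | a (l : ℕ) : RedCoord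
  | b (k : ℕ) : RedCoord
  deriving DecidableEq

/-- Functions on the solution manifold. -/
abbrev RedFun : Type := SmoothFun RedCoord

/-- The coefficients of the total derivative with respect to `η`. -/
def etaField : RedCoord → RedFun
  | .eta => 1
  | .xi => 0
  -- `a 0` stands for `u_x - u_t`, which is `2 u_η`.
  | .u => (1 / 2 : ℝ) • coord (.a 0)
  | .a l => coord (.a (l + 1))
  | .b _ => 0

/-- The coefficients of the total derivative with respect to `ξ`. -/
def xiField : RedCoord → RedFun
  | .eta => 0
  | .xi => 1
  | .u => (1 / 2 : ℝ) • coord (.b 0)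
  | .a _ => 0
  | .b k => coord (.b (k + 1))

/-- The total derivative with respect to `η`. -/
abbrev DEta : RedFun →ₗ[ℝ] RedFun := vectorField etaField

/-- The total derivative with respect to `ξ`. -/
abbrev DXi : RedFun →ₗ[ℝ] RedFun := vectorField xiField

theorem DXi_DEta (f : RedFun) : DXi (DEta f) = DEta (DXi f) := by
  rw [DXi, DEta, vectorField_vectorField xiField etaField f]
  have : (fun i => vectorField xiField (etaField i) - vectorField etaField (xiField i)) = 0 := by
    funext i
    cases i <;> simp [etaField, xiField]
  rw [this]
  simp [vectorField_apply]

theorem pd_DEta (c : RedCoord) (g : RedFun) (f : RedFun) (d : RedCoord)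
    (h : ∀ k, pd c (etaField k) = if k = d then g else 0) :
    pd c (DEta f) = DEta (pd c f) + g * pd d f := by
  rw [DEta, pd_vectorField]
  congr 1
  rw [vectorField_apply, finsum_eq_single _ d fun k hk => by simp [h, hk]]
  simp [h]

theorem pd_DXi (c : RedCoord) (g : RedFun) (f : RedFun) (d : RedCoord)
    (h : ∀ k, pd c (xiField k) = if k = d then g else 0) :
    pd c (DXi f) = DXi (pd c f) + g * pd d f := by
  rw [DXi, pd_vectorField]
  congr 1
  rw [vectorField_apply, finsum_eq_single _ d fun k hk => by simp [h, hk]]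
  simp [h]

theorem pd_a_succ_DEta (l : ℕ) (f : RedFun) :
    pd (.a (l + 1)) (DEta f) = DEta (pd (.a (l + 1)) f) + pd (.a l) f := by
  rw [pd_DEta _ 1 _ (.a l), one_mul]
  intro k
  cases k <;> simp [etaField, pd_coord]

theorem pd_a_zero_DEta (f : RedFun) :
    pd (.a 0) (DEta f) = DEta (pd (.a 0) f) + (1 / 2 : ℝ) • pd .u f := by
  rw [pd_DEta _ ((1 / 2 : ℝ) • 1) _ .u, smul_one_mul]
  intro k
  cases k <;> simp [etaField, pd_coord]

theorem pd_DEta_of_ne {c : RedCoord} (hc : ∀ l, c ≠ .a l) (f : RedFun) :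
    pd c (DEta f) = DEta (pd c f) := by
  rw [pd_DEta _ 0 _ .u, zero_mul, add_zero]
  intro k
  have := fun l => (hc l).symm
  cases k <;> simp [etaField, pd_coord, this]

theorem pd_b_succ_DXi (l : ℕ) (f : RedFun) :
    pd (.b (l + 1)) (DXi f) = DXi (pd (.b (l + 1)) f) + pd (.b l) f := by
  rw [pd_DXi _ 1 _ (.b l), one_mul]
  intro k
  cases k <;> simp [xiField, pd_coord]

theorem pd_b_zero_DXi (f : RedFun) :
    pd (.b 0) (DXi f) = DXi (pd (.b 0) f) + (1 / 2 : ℝ) • pd .u f := by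
  rw [pd_DXi _ ((1 / 2 : ℝ) • 1) _ .u, smul_one_mul]
  intro k
  cases k <;> simp [xiField, pd_coord]

/-! ### Functions annihilated by the total derivative with respect to `η` -/

/-- Differentiating `D_η f = 0` by `a (k+1)` expresses `∂f/∂(a k)` through `∂f/∂(a (k+1))`. -/
theorem pd_a_eq_zero_of_DEta_eq_zero {f : RedFun} (hf : DEta f = 0) (l : ℕ) : pd (.a l) f = 0 := by
  refine forall_pd_of_step (c := RedCoord.a) (fun _ _ h => by simpa using h)
    (P := fun g => g = 0) rfl (fun k hk => ?_) l
  have := pd_a_succ_DEta k f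
  simpa [hf, hk] using this.symm

theorem pd_u_eq_zero_of_DEta_eq_zero {f : RedFun} (hf : DEta f = 0) : pd .u f = 0 := by
  have := pd_a_zero_DEta f
  simpa [hf, pd_a_eq_zero_of_DEta_eq_zero hf] using this.symm

theorem pd_eta_eq_zero_of_DEta_eq_zero {f : RedFun} (hf : DEta f = 0) : pd .eta f = 0 := by
  have h : DEta f = pd .eta f := by
    rw [DEta, vectorField_apply, finsum_eq_single _ RedCoord.eta]
    · simp [etaField]
    · intro k hk
      cases k with
      | eta => exact absurd rfl hk
      | xi => simp [etaField]
      | u => simp [pd_u_eq_zero_of_DEta_eq_zero hf]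
      | a l => simp [pd_a_eq_zero_of_DEta_eq_zero hf]
      | b l => simp [etaField]
  rw [← h, hf]

/-- The coordinates other than `η` and `a l`. -/
def OffEta : RedCoord → Prop
  | .eta => False
  | .a _ => False
  | _ => True

/-- The coordinates other than `ξ` and `b k`. -/
def OffXi : RedCoord → Prop
  | .xi => False
  | .b _ => False
  | _ => True

/-- The coordinates `ξ` and `b k`. -/
def OnXi : RedCoord → Prop
  | .xi => True
  | .b _ => True
  | _ => False

instance : DecidablePred OffEta := fun c => by cases c <;> unfold OffEta <;> infer_instance
instance : DecidablePred OffXi := fun c => by cases c <;> unfold OffXi <;> infer_instance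
instance : DecidablePred OnXi := fun c => by cases c <;> unfold OnXi <;> infer_instance

/-- Functions of `z, v_l` as functions of `η, a l`. -/
def etaIncl : LineCoord → RedFun
  | .z => coord .eta
  | .v l => coord (.a l)

/-- Functions of `z, v_k` as functions of `ξ, b k`. -/
def xiIncl : LineCoord → RedFun
  | .z => coord .xi
  | .v k => coord (.b k)

/-- Restriction to the values of `η, a l`. -/
def etaProj : RedCoord → LineFun
  | .eta => coord .z
  | .a l => coord (.v l)
  | _ => 0

/-- Restriction to the values of `ξ, b k`. -/
def xiProj : RedCoord → LineFun
  | .xi => coord .z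
  | .b k => coord (.v k)
  | _ => 0

theorem exists_subst_etaIncl {f : RedFun} (h : ∀ c, OffEta c → pd c f = 0) :
    ∃ F, f = subst etaIncl F := by
  refine ⟨subst etaProj f, ?_⟩
  rw [subst_subst]
  conv_lhs => rw [← subst_zeroing_eq_self OffEta h]
  congr 2
  funext c
  cases c <;> simp [zeroing, OffEta, etaProj, etaIncl]

theorem exists_subst_xiIncl {f : RedFun} (h : ∀ c, OffXi c → pd c f = 0) :
    ∃ G, f = subst xiIncl G := by
  refine ⟨subst xiProj f, ?_⟩
  rw [subst_subst]
  conv_lhs => rw [← subst_zeroing_eq_self OffXi h]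
  congr 2
  funext c
  cases c <;> simp [zeroing, OffXi, xiProj, xiIncl]

theorem exists_subst_xiIncl_of_DEta_eq_zero {f : RedFun} (hf : DEta f = 0) :
    ∃ G, f = subst xiIncl G := by
  refine exists_subst_xiIncl fun c hc => ?_
  cases c with
  | eta => exact pd_eta_eq_zero_of_DEta_eq_zero hf
  | u => exact pd_u_eq_zero_of_DEta_eq_zero hf
  | a l => exact pd_a_eq_zero_of_DEta_eq_zero hf l
  | xi => exact hc.elim
  | b k => exact hc.elim

theorem DEta_subst_etaIncl (F : LineFun) :
    DEta (subst etaIncl F) = subst etaIncl (lineD F) := by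
  rw [lineD_eq]
  refine vectorField_subst_of_related (fun c => ?_) F
  cases c <;> simp [etaIncl, etaField, lineField]

theorem DXi_subst_etaIncl (F : LineFun) : DXi (subst etaIncl F) = 0 := by
  have := vectorField_subst_of_related (φ := etaIncl) (X := 0) (Y := xiField)
    (fun c => by cases c <;> simp [etaIncl, xiField]) F
  rw [DXi, this]
  simp [vectorField_apply]

theorem DXi_subst_xiIncl (F : LineFun) :
    DXi (subst xiIncl F) = subst xiIncl (lineD F) := by
  rw [lineD_eq]
  refine vectorField_subst_of_related (fun c => ?_) F
  cases c <;> simp [xiIncl, xiField, lineField]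

theorem DEta_subst_xiIncl (F : LineFun) : DEta (subst xiIncl F) = 0 := by
  have := vectorField_subst_of_related (φ := xiIncl) (X := 0) (Y := etaField)
    (fun c => by cases c <;> simp [xiIncl, etaField]) F
  rw [DEta, this]
  simp [vectorField_apply]

/-! ### Conserved currents in light-cone variables -/

theorem mul_mem_range_vectorField {ι : Type} [DecidableEq ι] {X : ι → SmoothFun ι}
    {c g : SmoothFun ι} (hc : vectorField X c = 0) (hg : g ∈ LinearMap.range (vectorField X)) :
    c * g ∈ LinearMap.range (vectorField X) := by
  obtain ⟨h, rfl⟩ := hg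
  exact ⟨c * h, by simp [hc]⟩

section Conserved

variable {A B : RedFun} (hAB : DXi A + DEta B = 0)
include hAB

/-- The derivative of the relation by `b (k+1)` reads `∂A/∂(b k) = -D_ξ ∂A/∂(b (k+1)) - D_η ∂B/∂(b
(k+1))`. Since `D_ξ` and `D_η` commute, exactness descends from `k+1` to `k`. -/
theorem pd_b_mem_range (k : ℕ) : pd (.b k) A ∈ LinearMap.range DEta := by
  refine forall_pd_of_step (c := RedCoord.b) (fun _ _ h => by simpa using h)
    (P := fun g => g ∈ LinearMap.range DEta) (zero_mem _) (fun k hk => ?_) k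
  obtain ⟨h, hh⟩ := hk
  have h1 := congrArg (pd (.b (k + 1))) hAB
  rw [map_add, pd_b_succ_DXi, pd_DEta_of_ne (by simp), ← hh, DXi_DEta, map_zero] at h1
  refine ⟨-(DXi h + pd (.b (k + 1)) B), ?_⟩
  rw [map_neg, map_add, ← sub_eq_zero, ← neg_eq_zero, ← h1]
  abel

theorem pd_u_mem_range : pd .u A ∈ LinearMap.range DEta := by
  obtain ⟨h, hh⟩ := pd_b_mem_range hAB 0
  have h1 := congrArg (pd (.b 0)) hAB
  rw [map_add, pd_b_zero_DXi, pd_DEta_of_ne (by simp), ← hh, DXi_DEta, map_zero] at h1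
  refine ⟨-(2 : ℝ) • (DXi h + pd (.b 0) B), ?_⟩
  have h2 : (1 / 2 : ℝ) • pd .u A = -(DEta (DXi h) + DEta (pd (.b 0) B)) := by
    rw [← sub_eq_zero, ← h1]
    abel
  rw [map_smul, map_add, neg_smul, ← smul_neg, ← h2, smul_smul]
  norm_num

/-- `D_ξ A = -D_η B` is exact and differs from `∂A/∂ξ` by exact derivatives of `A` multiplied by
functions of the `b k`; `D_η` annihilates these factors, so the products remain exact. -/
theorem pd_xi_mem_range : pd .xi A ∈ LinearMap.range DEta := by
  obtain ⟨S, hS⟩ := exists_finset_pd A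
  have h1 : DXi A - pd .xi A ∈ LinearMap.range DEta := by
    have h2 : DXi A = pd .xi A + vectorField (Function.update xiField .xi 0) A := by
      rw [← vectorField_single, ← vectorField_add_field]
      congr 1
      refine congrArg _ (funext fun c => ?_)
      by_cases hc : c = .xi
      · subst hc; simp [xiField]
      · simp [hc]
    rw [h2, add_sub_cancel_left, vectorField_eq_sum _ hS]
    refine sum_mem fun c _ => ?_
    cases c with
    | eta => simp [xiField]
    | xi => simp
    | u => exact mul_mem_range_vectorField (by simp [xiField, etaField]) (pd_u_mem_range hAB)
    | a l => simp [xiField]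
    | b k => exact mul_mem_range_vectorField (by simp [xiField, etaField]) (pd_b_mem_range hAB k)
  have h2 : DXi A ∈ LinearMap.range DEta := ⟨-B, by rw [map_neg, ← add_eq_zero_iff_neg_eq', hAB]⟩
  simpa using sub_mem h2 h1

/-- Scaling `ξ` and the `b k` commutes with `D_η`, and the derivative in the scaling parameter
combines the exact `∂A/∂ξ` and `∂A/∂(b k)` with factors annihilated by `D_η`. -/
theorem sub_zeroing_onXi_mem_range : A - subst (zeroing OnXi) A ∈ LinearMap.range DEta := by
  apply sub_zeroing_mem_range
  obtain ⟨S, hS, h⟩ := pd_none_scaling OnXi A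
  rw [h]
  have h1 : ∀ g ∈ LinearMap.range DEta, subst (scaling OnXi) g ∈
      LinearMap.range (vectorField (liftField etaField)) := by
    rintro _ ⟨g, rfl⟩
    refine ⟨subst (scaling OnXi) g, vectorField_subst_of_related (fun c => ?_) g⟩
    cases c <;> simp [scaling, OnXi, etaField, liftField, liftOption]
  refine sum_mem fun c _ => ?_
  cases c with
  | eta => simp [OnXi]
  | xi =>
    rw [if_pos (show OnXi .xi from trivial)]
    exact mul_mem_range_vectorField (by simp [liftField, etaField]) (h1 _ (pd_xi_mem_range hAB))
  | u => simp [OnXi]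
  | a l => simp [OnXi]
  | b k =>
    rw [if_pos (show OnXi (.b k) from trivial)]
    exact mul_mem_range_vectorField (by simp [liftField, etaField]) (h1 _ (pd_b_mem_range hAB k))

theorem exists_eq_subst_add_DEta : ∃ F H, A = subst etaIncl F + DEta H := by
  obtain ⟨H₁, hH₁⟩ := sub_zeroing_onXi_mem_range hAB
  obtain ⟨h, hh⟩ := pd_u_mem_range hAB
  -- `D_η H₂` has the same `u`-derivative as `A` at `ξ = b = 0`, so subtracting it removes `u`
  -- without bringing back `ξ` or any `b k`.
  obtain ⟨H₂, hu, hc⟩ := exists_primitive RedCoord.u (subst (zeroing OnXi) h)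
  have hrel : DEta (subst (zeroing OnXi) h) = subst (zeroing OnXi) (DEta h) := by
    refine vectorField_subst_of_related (fun c => ?_) h
    cases c <;> simp [zeroing, OnXi, etaField]
  have hon : ∀ c, OnXi c → c ≠ .u → (∀ l, c ≠ .a l) →
      pd c (subst (zeroing OnXi) A - DEta H₂) = 0 := fun c h1 h2 h3 => by
    rw [map_sub, pd_subst_zeroing_of_pos _ h1, pd_DEta_of_ne h3,
      hc c h2 (pd_subst_zeroing_of_pos _ h1 _), map_zero, sub_zero]
  obtain ⟨F, hF⟩ := exists_subst_etaIncl (f := subst (zeroing OnXi) A - DEta H₂) fun c hc => by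
    cases c with
    | eta => exact hc.elim
    | a l => exact hc.elim
    | u =>
      rw [map_sub, pd_subst_zeroing_of_neg OnXi (show ¬ OnXi .u from id), pd_DEta_of_ne (by simp), hu,
        hrel, hh, sub_self]
    | xi => exact hon _ trivial (by simp) (by simp)
    | b k => exact hon _ trivial (by simp) (by simp)
  refine ⟨F, H₁ + H₂, ?_⟩
  rw [← hF, map_add, hH₁]
  abel

theorem exists_reduced_form :
    ∃ F G H, A = subst etaIncl F + DEta H ∧ B = subst xiIncl G - DXi H := by
  obtain ⟨F, H, hA⟩ := exists_eq_subst_add_DEta hAB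
  have h1 : DEta (B + DXi H) = 0 := by
    rw [← hAB, hA, map_add, map_add, DXi_subst_etaIncl, DXi_DEta]
    abel
  obtain ⟨G, hG⟩ := exists_subst_xiIncl_of_DEta_eq_zero h1
  exact ⟨F, G, H, hA, by rw [← hG, add_sub_cancel_right]⟩

end Conserved

/-! ### Restriction to the solution manifold -/

theorem vectorField_sub_field {ι : Type} [DecidableEq ι] (X Y : ι → SmoothFun ι)
    (f : SmoothFun ι) :
    vectorField (fun i => X i - Y i) f = vectorField X f - vectorField Y f := by
  obtain ⟨S, hS⟩ := exists_finset_pd f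
  simp only [vectorField_eq_sum _ hS, sub_mul, Finset.sum_sub_distrib]

/-- The coefficients of `Dt`. -/
def tField : JetCoord → DiffFun
  | .t => 1
  | .x => 0
  | .u i j => u (i + 1) j

/-- The coefficients of `Dx`. -/
def xField : JetCoord → DiffFun
  | .t => 0
  | .x => 1
  | .u i j => u i (j + 1)

theorem Dt_eq : Dt = vectorField tField := by
  refine congrArg _ (funext fun c => ?_)
  cases c <;> rfl

theorem Dx_eq : Dx = vectorField xField := by
  refine congrArg _ (funext fun c => ?_)
  cases c <;> rfl

@[simp] theorem Dt_u (i j : ℕ) : Dt (u i j) = u (i + 1) j := by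
  rw [Dt_eq]
  exact vectorField_coord _ _

@[simp] theorem Dx_u (i j : ℕ) : Dx (u i j) = u i (j + 1) := by
  rw [Dx_eq]
  exact vectorField_coord _ _

theorem Dt_mul (f g : DiffFun) : Dt (f * g) = Dt f * g + f * Dt g := by
  rw [Dt_eq, vectorField_mul]

theorem Dx_mul (f g : DiffFun) : Dx (f * g) = Dx f * g + f * Dx g := by
  rw [Dx_eq, vectorField_mul]

theorem Dt_Dx (f : DiffFun) : Dt (Dx f) = Dx (Dt f) := by
  rw [Dt_eq, Dx_eq, vectorField_vectorField tField xField f]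
  have : (fun i => vectorField tField (xField i) - vectorField xField (tField i)) = 0 := by
    funext i
    cases i <;> simp [tField, xField, u]
  rw [this]
  simp [vectorField_apply]

theorem Div_apply (P Q : DiffFun) : Div (P, Q) = Dt P + Dx Q := rfl

theorem Div_curl (K : DiffFun) : Div (Dx K, -Dt K) = 0 := by
  rw [Div_apply, map_neg, Dt_Dx, add_neg_cancel]

/-- The parametrization of the solution manifold. -/
def rho : JetCoord → RedFun
  | .t => (1 / 2 : ℝ) • (coord .xi - coord .eta)
  | .x => (1 / 2 : ℝ) • (coord .xi + coord .eta)
  | .u i j =>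
    match i + j with
    | 0 => coord .u
    -- On solutions `u_{ij}` depends only on `i + j` and the parity of `i`, and `b n ± a n` is twice
    -- the value for even and odd `i`.
    | n + 1 => (1 / 2 : ℝ) • (coord (.b n) + (-1 : ℝ) ^ i • coord (.a n))

theorem rho_u_zero : rho (.u 0 0) = coord .u := rfl

theorem rho_u {i j n : ℕ} (h : i + j = n + 1) :
    rho (.u i j) = (1 / 2 : ℝ) • (coord (.b n) + (-1 : ℝ) ^ i • coord (.a n)) := by
  simp [rho, h]

/-- The coordinates of the reduced jet space as differential functions. -/
def sigma : RedCoord → DiffFun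
  | .eta => coord .x - coord .t
  | .xi => coord .x + coord .t
  | .u => u 0 0
  | .a l => u 0 (l + 1) - u 1 l
  | .b k => u 0 (k + 1) + u 1 k

/-- The restriction of differential functions to the solution manifold. -/
abbrev restrict : DiffFun →ₗ[ℝ] RedFun := subst rho

theorem subst_rho_u (i j : ℕ) : restrict (u i j) = rho (.u i j) := rfl

theorem restrict_sigma (c : RedCoord) : restrict (sigma c) = coord c := by
  refine ext_eval fun p => ?_
  cases c with
  | eta => simp [sigma, rho]; ring
  | xi => simp [sigma, rho]; ring
  | u => rfl
  | a l =>
    rw [sigma, map_sub, subst_rho_u, subst_rho_u, rho_u (zero_add (l + 1)), rho_u (add_comm 1 l)]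
    simp
    ring
  | b l =>
    rw [sigma, map_add, subst_rho_u, subst_rho_u, rho_u (zero_add (l + 1)), rho_u (add_comm 1 l)]
    simp
    ring

theorem restrict_subst_sigma (f : RedFun) : restrict (subst sigma f) = f := by
  rw [subst_subst]
  simp only [restrict_sigma, subst_id]

theorem rho_mem_solutionManifold (q : RedCoord → ℝ) :
    (fun c => eval q (rho c)) ∈ solutionManifold := by
  intro i j
  change eval q (rho _) = eval q (rho _)
  rw [rho_u (n := i + j + 1) (by omega), rho_u (n := i + j + 1) (by omega), pow_add]
  simp

theorem eval_rho_of_mem {p : JetCoord → ℝ} (hp : p ∈ solutionManifold) (c : JetCoord) :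
    eval (fun r => eval p (sigma r)) (rho c) = p c := by
  have key : ∀ i j n, i + j = n + 1 →
      eval (fun r => eval p (sigma r)) (rho (.u i j)) = p (.u i j) := by
    intro i
    -- The equation trades two `t`-derivatives for two `x`-derivatives, so `i` descends by two.
    induction i using Nat.twoStepInduction with
    | zero =>
      intro j n h
      obtain rfl : j = n + 1 := by omega
      rw [rho_u h]
      simp [sigma, u]
      ring
    | one =>
      intro j n h
      obtain rfl : j = n := by omega
      rw [rho_u h]
      simp [sigma, u]
      ring
    | more i ih _ =>
      intro j n h
      rw [hp i j, ← ih (j + 2) n (by omega), rho_u h, rho_u (n := n) (by omega), pow_add]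
      simp
  cases c with
  | t => simp [rho, sigma]; ring
  | x => simp [rho, sigma]; ring
  | u i j =>
    rcases h : i + j with _ | n
    · obtain ⟨rfl, rfl⟩ : i = 0 ∧ j = 0 := by omega
      rfl
    · exact key i j n h

/-- `rho` takes values in the solution manifold, and `sigma` gives parameters for every point of it.
-/
theorem mem_vanishOnSol {f : DiffFun} : f ∈ VanishOnSol ↔ restrict f = 0 := by
  constructor
  · intro h
    exact ext_eval fun q => h _ (rho_mem_solutionManifold q)
  · intro h p hp
    have := congrArg (eval fun r => eval p (sigma r)) h
    rw [eval_subst, map_zero] at this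
    simp only [eval_rho_of_mem hp] at this
    exact this

theorem vanishOnSol_mul {a : DiffFun} (ha : a ∈ VanishOnSol) (b : DiffFun) :
    a * b ∈ VanishOnSol := by
  rw [mem_vanishOnSol] at ha ⊢
  rw [subst_mul, ha, zero_mul]

theorem restrict_Dt (f : DiffFun) : restrict (Dt f) = (DXi - DEta) (restrict f) := by
  rw [Dt_eq, LinearMap.sub_apply, ← vectorField_sub_field]
  refine (vectorField_subst_of_related (fun c => ?_) f).symm
  cases c with
  | t =>
    simp only [rho, tField, map_smul, map_sub, vectorField_coord]
    simp [xiField, etaField, ← two_smul ℝ (1 : RedFun), smul_smul]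
  | x => simp [rho, tField, xiField, etaField]
  | u i j =>
    rw [tField, subst_rho_u]
    rcases h : i + j with _ | n
    · obtain ⟨rfl, rfl⟩ : i = 0 ∧ j = 0 := by omega
      rw [rho_u_zero, rho_u (n := 0) (by omega)]
      simp [xiField, etaField, sub_eq_add_neg]
    · rw [rho_u h, rho_u (n := n + 1) (by omega)]
      simp [xiField, etaField, pow_succ]

theorem restrict_Dx (f : DiffFun) : restrict (Dx f) = (DXi + DEta) (restrict f) := by
  rw [Dx_eq, LinearMap.add_apply, ← vectorField_add_field]
  refine (vectorField_subst_of_related (fun c => ?_) f).symm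
  cases c with
  | t => simp [rho, xField, xiField, etaField]
  | x =>
    simp only [rho, xField, map_smul, map_add, vectorField_coord]
    simp [xiField, etaField, ← two_smul ℝ (1 : RedFun), smul_smul]
  | u i j =>
    rw [xField, subst_rho_u]
    rcases h : i + j with _ | n
    · obtain ⟨rfl, rfl⟩ : i = 0 ∧ j = 0 := by omega
      rw [rho_u_zero, rho_u (n := 0) (by omega)]
      simp [xiField, etaField]
    · rw [rho_u h, rho_u (n := n + 1) (by omega)]
      simp [xiField, etaField]

theorem Dx_mem_vanishOnSol {f : DiffFun} (hf : f ∈ VanishOnSol) : Dx f ∈ VanishOnSol := by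
  rw [mem_vanishOnSol] at hf ⊢
  rw [restrict_Dx, hf, map_zero]

theorem Dt_mem_vanishOnSol {f : DiffFun} (hf : f ∈ VanishOnSol) : Dt f ∈ VanishOnSol := by
  rw [mem_vanishOnSol] at hf ⊢
  rw [restrict_Dt, hf, map_zero]

theorem waveExpr_mem : waveExpr ∈ VanishOnSol := fun p hp => by
  change p _ - p _ = 0
  rw [hp 0 0, sub_self]

theorem Dx_pow_waveExpr (l : ℕ) : (Dx ^ l) waveExpr = u 2 l - u 0 (l + 2) := by
  induction l with
  | zero => rfl
  | succ l ih =>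
    rw [pow_succ', Module.End.mul_apply, ih, map_sub, Dx_u, Dx_u]

/-! ### The currents of the special form -/

/-- The substitution defining `evalEta`. -/
def etaMap : LineCoord → DiffFun
  | .z => coord .x - coord .t
  | .v l => u 0 (l + 1) - u 1 l

/-- The substitution defining `evalXi`. -/
def xiMap : LineCoord → DiffFun
  | .z => coord .x + coord .t
  | .v k => u 0 (k + 1) + u 1 k

theorem evalEta_eq : evalEta = subst etaMap := by
  refine congrArg _ (funext fun c => ?_)
  cases c <;> rfl

theorem evalXi_eq : evalXi = subst xiMap := by
  refine congrArg _ (funext fun c => ?_)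
  cases c <;> rfl

theorem evalEta_eq_subst_sigma (F : LineFun) : evalEta F = subst sigma (subst etaIncl F) := by
  rw [evalEta_eq, subst_subst]
  congr 2
  funext c
  cases c <;> rfl

theorem evalXi_eq_subst_sigma (G : LineFun) : evalXi G = subst sigma (subst xiIncl G) := by
  rw [evalXi_eq, subst_subst]
  congr 2
  funext c
  cases c <;> rfl

theorem restrict_evalEta (F : LineFun) : restrict (evalEta F) = subst etaIncl F := by
  rw [evalEta_eq_subst_sigma, restrict_subst_sigma]

theorem restrict_evalXi (G : LineFun) : restrict (evalXi G) = subst xiIncl G := by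
  rw [evalXi_eq_subst_sigma, restrict_subst_sigma]

theorem Dx_etaMap (c : LineCoord) : vectorField xField (etaMap c) = subst etaMap (lineField c) := by
  cases c <;> simp [etaMap, xField, lineField, u]

theorem Dx_xiMap (c : LineCoord) : vectorField xField (xiMap c) = subst xiMap (lineField c) := by
  cases c <;> simp [xiMap, xField, lineField, u]

theorem Dx_evalEta (F : LineFun) : Dx (evalEta F) = evalEta (lineD F) := by
  rw [Dx_eq, evalEta_eq, lineD_eq]
  exact vectorField_subst_of_related Dx_etaMap F

theorem Dx_evalXi (G : LineFun) : Dx (evalXi G) = evalXi (lineD G) := by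
  rw [Dx_eq, evalXi_eq, lineD_eq]
  exact vectorField_subst_of_related Dx_xiMap G

/-- Used with `Y = D_t + D_x` for `η` and `Y = D_x - D_t` for `ξ`. The chain rule leaves `-∑ (D_x^l
waveExpr) ∂_{v_l} F`, and since `D_x` acts as `lineD` along `φ` even off solutions, integration by
parts yields the Euler expression. -/
theorem add_lineEuler_mul_waveExpr_mem {φ : LineCoord → DiffFun} {Y : JetCoord → DiffFun}
    (h1 : ∀ c, vectorField xField (φ c) = subst φ (lineField c))
    (hz : vectorField Y (φ .z) = 0)
    (hv : ∀ l, vectorField Y (φ (.v l)) = -(Dx ^ l) waveExpr) (F : LineFun) :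
    vectorField Y (subst φ F) + subst φ (lineEuler F) * waveExpr ∈ VanishOnSol.map Dx := by
  obtain ⟨S, hS, h⟩ := vectorField_subst (ι := JetCoord) F
  rw [h, lineEuler_eq, sumPd_eq_sum _ hS, map_sum, Finset.sum_mul, ← Finset.sum_add_distrib]
  refine sum_mem fun c _ => ?_
  have h2 : ∀ g, (-Dx) (subst φ g) = subst φ ((-lineD) g) := fun g => by
    rw [LinearMap.neg_apply, LinearMap.neg_apply, Dx_eq, lineD_eq, map_neg,
      vectorField_subst_of_related h1]
  cases c with
  | z => simp [hz, eulerCoeff]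
  | v l =>
    rw [hv, eulerCoeff, ← pow_apply_of_intertwine h2]
    have h3 := integration_by_parts Dx Dx_mul VanishOnSol (fun a ha b => vanishOnSol_mul ha b)
      (fun a ha => Dx_mem_vanishOnSol ha) l waveExpr waveExpr_mem (subst φ (pd (.v l) F))
    rw [← neg_mem_iff]
    convert h3 using 1
    ring

theorem current_apply (F G : LineFun) :
    current (F, G) = (evalEta F - evalXi G, evalEta F + evalXi G) := by
  simp [current, sub_eq_add_neg]

theorem characteristicOf_apply (F G : LineFun) :
    characteristicOf (F, G) = -(evalEta (lineEuler F) + evalXi (lineEuler G)) := rfl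

theorem Dt_add_Dx_evalEta (F : LineFun) :
    Dt (evalEta F) + Dx (evalEta F) + evalEta (lineEuler F) * waveExpr ∈
      VanishOnSol.map Dx := by
  rw [Dt_eq, Dx_eq, ← vectorField_add_field, evalEta_eq, ← Dx_eq]
  refine add_lineEuler_mul_waveExpr_mem Dx_etaMap ?_ (fun l => ?_) F
  · simp [etaMap, tField, xField]
  · rw [Dx_pow_waveExpr]
    simp [etaMap, tField, xField, u]
    abel

theorem Dx_sub_Dt_evalXi (G : LineFun) :
    Dx (evalXi G) - Dt (evalXi G) + evalXi (lineEuler G) * waveExpr ∈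
      VanishOnSol.map Dx := by
  rw [Dt_eq, Dx_eq, ← vectorField_sub_field, evalXi_eq, ← Dx_eq]
  refine add_lineEuler_mul_waveExpr_mem Dx_xiMap ?_ (fun l => ?_) G
  · simp [xiMap, tField, xField]
  · rw [Dx_pow_waveExpr]
    simp [xiMap, tField, xField, u]

theorem mem_trivialCurrent_of_vanish {P Q : DiffFun} (hP : P ∈ VanishOnSol)
    (hQ : Q ∈ VanishOnSol) : (P, Q) ∈ TrivialCurrent :=
  Submodule.mem_sup_left ⟨hP, hQ⟩

theorem curl_mem_trivialCurrent (K : DiffFun) : (Dx K, -Dt K) ∈ TrivialCurrent :=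
  Submodule.mem_sup_right (Div_curl K)

theorem exists_current_with_characteristic (F G : LineFun) : ∃ c : DiffFun × DiffFun,
    c - current (F, G) ∈ TrivialCurrent ∧ Div c = characteristicOf (F, G) * waveExpr := by
  obtain ⟨Z₁, h₁, e₁⟩ := Dt_add_Dx_evalEta F
  obtain ⟨Z₂, h₂, e₂⟩ := Dx_sub_Dt_evalXi G
  -- The error terms are `D_x Z₁` and `D_x Z₂` with `Z₁, Z₂` vanishing on solutions, so the second
  -- component absorbs them.
  refine ⟨current (F, G) - (0, Z₁ + Z₂), ?_, ?_⟩
  · rw [sub_sub_cancel_left]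
    exact neg_mem (mem_trivialCurrent_of_vanish (zero_mem _) (add_mem h₁ h₂))
  · rw [map_sub, current_apply, Div_apply, Div_apply, map_add Dx Z₁, e₁, e₂,
      characteristicOf_apply]
    simp only [map_add, map_sub, map_zero]
    ring

/-! ### Trivial currents have trivial characteristics -/

/-- The coefficients of the derivative transversal to the solution manifold that corresponds to the
coordinate `u_{i,j} - u_{i-2,j+2}`. -/
def normalField (i j : ℕ) : JetCoord → DiffFun
  | .u i' j' => if i ≤ i' ∧ i' % 2 = i % 2 ∧ i' + j' = i + j then 1 else 0
  | _ => 0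

theorem vectorField_normalField (X : JetCoord → DiffFun) (i j : ℕ) (c : JetCoord) :
    vectorField X (normalField i j c) = 0 := by
  cases c with
  | t => simp [normalField]
  | x => simp [normalField]
  | u i' j' => rw [normalField]; split_ifs <;> simp

theorem normalField_Dt (i j : ℕ) (f : DiffFun) :
    vectorField (normalField (i + 1) j) (Dt f) =
      Dt (vectorField (normalField (i + 1) j) f) + vectorField (normalField i j) f := by
  rw [Dt_eq, vectorField_vectorField (normalField (i + 1) j) tField f]
  congr 2
  refine congrArg _ (funext fun c => ?_)
  rw [vectorField_normalField, sub_zero]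
  cases c with
  | t => simp [tField, normalField]
  | x => simp [tField, normalField]
  | u i' j' =>
    simp only [tField, u, vectorField_coord, normalField]
    congr 1
    simp only [eq_iff_iff]
    omega

theorem normalField_Dx_succ (i j : ℕ) (f : DiffFun) :
    vectorField (normalField i (j + 1)) (Dx f) =
      Dx (vectorField (normalField i (j + 1)) f) + vectorField (normalField i j) f := by
  rw [Dx_eq, vectorField_vectorField (normalField i (j + 1)) xField f]
  congr 2
  refine congrArg _ (funext fun c => ?_)
  rw [vectorField_normalField, sub_zero]
  cases c with
  | t => simp [xField, normalField]
  | x => simp [xField, normalField]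
  | u i' j' =>
    simp only [xField, u, vectorField_coord, normalField]
    congr 1
    simp only [eq_iff_iff]
    omega

theorem normalField_Dx_zero (i : ℕ) (f : DiffFun) :
    vectorField (normalField i 0) (Dx f) = Dx (vectorField (normalField i 0) f) := by
  rw [Dx_eq, vectorField_vectorField (normalField i 0) xField f]
  have : (fun c => vectorField (normalField i 0) (xField c) -
      vectorField xField (normalField i 0 c)) = 0 := by
    funext c
    rw [vectorField_normalField, sub_zero]
    cases c with
    | t => simp [xField]
    | x => simp [xField]
    | u i' j' =>
      simp only [xField, u, vectorField_coord, normalField]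
      exact if_neg (by omega)
  rw [this]
  simp [vectorField_apply]

/-- For `i = 1` the field is tangent to the solution manifold: it raises all `u_{i'j'}` of order `j
+ 1` with odd `i'` by the same amount, which is `∂_{b j} - ∂_{a j}`. -/
theorem restrict_normalField_one {f : DiffFun} (hf : f ∈ VanishOnSol) (j : ℕ) :
    restrict (vectorField (normalField 1 j) f) = 0 := by
  rw [mem_vanishOnSol] at hf
  have h := vectorField_subst_of_related (φ := rho) (X := normalField 1 j)
    (Y := fun c => (Pi.single (.b j) 1 : RedCoord → RedFun) c -
      (Pi.single (.a j) 1 : RedCoord → RedFun) c) (fun c => ?_) f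
  · rw [← h, hf, map_zero]
  · rw [vectorField_sub_field, vectorField_single, vectorField_single]
    cases c with
    | t => simp [rho, normalField, pd_coord]
    | x => simp [rho, normalField, pd_coord]
    | u i' j' =>
      rcases h : i' + j' with _ | n
      · obtain ⟨rfl, rfl⟩ : i' = 0 ∧ j' = 0 := by omega
        simp [rho_u_zero, normalField, pd_coord]
      · rw [rho_u h, normalField]
        by_cases hn : n = j
        · subst hn
          rcases Nat.even_or_odd i' with hi | hi
          · rw [if_neg (by have := Nat.even_iff.1 hi; omega)]
            simp [pd_coord, hi.neg_one_pow]
          · rw [if_pos (by have := Nat.odd_iff.1 hi; omega)]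
            simp [pd_coord, hi.neg_one_pow, ← add_smul]
            norm_num
        · rw [if_neg (by omega)]
          simp [pd_coord, hn]

theorem exists_bound_normalField (f : DiffFun) :
    ∃ n, ∀ i j, n ≤ i + j → vectorField (normalField i j) f = 0 := by
  obtain ⟨S, hS⟩ := exists_finset_pd f
  let w : JetCoord → ℕ := fun c => match c with
    | .u i j => i + j
    | _ => 0
  refine ⟨S.sup w + 1, fun i j hij => ?_⟩
  rw [vectorField_eq_sum _ hS]
  refine Finset.sum_eq_zero fun c hc => ?_
  have h1 : w c ≤ S.sup w := Finset.le_sup hc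
  cases c with
  | t => simp [normalField]
  | x => simp [normalField]
  | u i' j' =>
    have h2 : i' + j' ≤ S.sup w := h1
    rw [normalField, if_neg (by omega), zero_mul]

theorem normalField_waveExpr (i j : ℕ) :
    vectorField (normalField (i + 2) j) waveExpr = if i = 0 ∧ j = 0 then 1 else 0 := by
  rw [waveExpr, map_sub, u, u, vectorField_coord, vectorField_coord, normalField, normalField,
    if_neg (c := i + 2 ≤ 0 ∧ _) (by omega), sub_zero]
  congr 1
  simp only [eq_iff_iff]
  omega

/-- The cancellation behind the vanishing of Euler operators on divergences; it is used once for
`D_t` and once for `D_x`. -/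
theorem sum_neg_pow_telescope {M : Type} [AddCommGroup M] [Module ℝ M] (d : M →ₗ[ℝ] M)
    {p r : ℕ → M} (h0 : d (p 0) = r 0) (hs : ∀ i, d (p (i + 1)) + p i = r (i + 1)) (n : ℕ) :
    ∑ i ∈ Finset.range (n + 1), ((-d) ^ i) (r i) = -((-d) ^ (n + 1)) (p n) := by
  induction n with
  | zero => simp [← h0]
  | succ n ih =>
    rw [Finset.sum_range_succ, ih, ← hs, map_add, pow_succ (-d) (n + 1), Module.End.mul_apply,
      LinearMap.neg_apply, map_neg]
    abel

/-- With `N i j` the derivative along `normalField i j`, the operator `∑ (-D_x)^j (-D_t)^i N (i+2)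
j`, restricted to solutions, sends `μ * waveExpr` to `μ`. It kills divergences up to the boundary
terms `N 1 j P`, which vanish because `P` does so on solutions. -/
theorem mem_vanishOnSol_of_Div_eq {P Q μ : DiffFun} (hP : P ∈ VanishOnSol)
    (h : Div (P, Q) = μ * waveExpr) : μ ∈ VanishOnSol := by
  rw [mem_vanishOnSol]
  obtain ⟨n₁, hn₁⟩ := exists_bound_normalField P
  obtain ⟨n₂, hn₂⟩ := exists_bound_normalField Q
  set p : ℕ → ℕ → RedFun := fun i j => restrict (vectorField (normalField i j) P) with hp
  set q : ℕ → ℕ → RedFun := fun i j => restrict (vectorField (normalField i j) Q) with hq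
  set dt : RedFun →ₗ[ℝ] RedFun := DXi - DEta with hdt
  set dx : RedFun →ₗ[ℝ] RedFun := DXi + DEta with hdx
  have hcomm : ∀ a, dx ((-dt) a) = (-dt) (dx a) := fun a => by
    simp [hdt, hdx, DXi_DEta]
    abel
  have hp1 : ∀ j, p 1 j = 0 := fun j => restrict_normalField_one hP j
  have hdiv : ∀ i j, restrict (vectorField (normalField (i + 2) j) (Dt P)) +
      restrict (vectorField (normalField (i + 2) j) (Dx Q)) =
        if i = 0 ∧ j = 0 then restrict μ else 0 := fun i j => by
    rw [← map_add, ← map_add, ← Div_apply, h, vectorField_mul, map_add, subst_mul,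
      mem_vanishOnSol.1 waveExpr_mem, mul_zero, zero_add, normalField_waveExpr]
    split_ifs <;> simp
  have hDt : ∀ i j, restrict (vectorField (normalField (i + 2) j) (Dt P)) =
      dt (p (i + 2) j) + p (i + 1) j := fun i j => by
    rw [normalField_Dt, map_add, restrict_Dt]
  have hsum : ∀ j, ∑ i ∈ Finset.range (n₁ + 1), ((-dt) ^ i)
      ((if i = 0 ∧ j = 0 then restrict μ else 0) -
        restrict (vectorField (normalField (i + 2) j) (Dx Q))) = 0 := fun j => by
    rw [sum_neg_pow_telescope dt (p := fun i => p (i + 2) j)]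
    · rw [hp]
      simp only
      -- The upper boundary term is zero, as its order exceeds that of `P`.
      rw [hn₁ _ _ (by omega), map_zero, map_zero, neg_zero]
    · rw [← hdiv, hDt, hp1]
      abel
    · intro i
      rw [← hdiv, hDt]
      abel
  have hsum' : ∀ j, ∑ i ∈ Finset.range (n₁ + 1), ((-dt) ^ i)
      (restrict (vectorField (normalField (i + 2) j) (Dx Q))) =
        if j = 0 then restrict μ else 0 := fun j => by
    have := hsum j
    simp only [map_sub, Finset.sum_sub_distrib] at this
    rw [← sub_eq_zero.1 this, Finset.sum_range_succ', Finset.sum_eq_zero]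
    · simp
    · intro i _
      simp
  have hdxsum : ∀ j, dx (∑ i ∈ Finset.range (n₁ + 1), ((-dt) ^ i) (q (i + 2) j)) =
      ∑ i ∈ Finset.range (n₁ + 1), ((-dt) ^ i) (dx (q (i + 2) j)) := fun j => by
    rw [map_sum]
    exact Finset.sum_congr rfl fun i _ =>
      (pow_apply_of_intertwine (f := dx) (S := -dt) (T := -dt) (fun a => (hcomm a).symm) i _).symm
  -- No lower boundary term arises here, since `N i 0` commutes with `D_x`.
  have hfin := sum_neg_pow_telescope dx (r := fun j => if j = 0 then restrict μ else 0)
    (p := fun j => ∑ i ∈ Finset.range (n₁ + 1), ((-dt) ^ i) (q (i + 2) j)) ?_ ?_ n₂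
  · rw [Finset.sum_range_succ', Finset.sum_eq_zero (by simp), Finset.sum_eq_zero] at hfin
    · simpa using hfin
    · intro i _
      rw [hq]
      simp only
      rw [hn₂ _ _ (by omega), map_zero, map_zero]
  · rw [hdxsum, ← hsum']
    exact Finset.sum_congr rfl fun i _ => by rw [normalField_Dx_zero, restrict_Dx]
  · intro j
    rw [hdxsum, ← hsum', ← Finset.sum_add_distrib]
    exact Finset.sum_congr rfl fun i _ => by
      rw [← map_add, normalField_Dx_succ, map_add restrict, restrict_Dx]

theorem mem_vanishOnSol_of_trivialCurrent {c : DiffFun × DiffFun} {μ : DiffFun}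
    (hc : c ∈ TrivialCurrent) (h : Div c = μ * waveExpr) : μ ∈ VanishOnSol := by
  obtain ⟨c₀, hc₀, c₁, hc₁, rfl⟩ := Submodule.mem_sup.1 hc
  rw [map_add, LinearMap.mem_ker.1 hc₁, add_zero] at h
  exact mem_vanishOnSol_of_Div_eq hc₀.1 h

/-! ### Conservation laws -/

theorem mem_conservedCurrent (P Q : DiffFun) : (P, Q) ∈ ConservedCurrent ↔
    DXi (restrict (P + Q)) + DEta (restrict (Q - P)) = 0 := by
  change Div (P, Q) ∈ VanishOnSol ↔ _
  rw [mem_vanishOnSol, Div_apply, map_add, restrict_Dt, restrict_Dx]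
  simp only [map_add, map_sub, LinearMap.sub_apply, LinearMap.add_apply]
  rw [iff_iff_eq]
  congr 1
  abel

theorem V_le_conservedCurrent : V ≤ ConservedCurrent := by
  rintro _ ⟨⟨F, G⟩, rfl⟩
  obtain ⟨c, h1, h2⟩ := exists_current_with_characteristic F G
  obtain ⟨Z, hZ, c₁, hc₁, e⟩ := Submodule.mem_sup.1 h1
  have h3 : current (F, G) = c - Z - c₁ := by rw [sub_sub, e, sub_sub_cancel]
  change Div _ ∈ VanishOnSol
  rw [h3, map_sub, map_sub, LinearMap.mem_ker.1 hc₁, sub_zero, h2]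
  refine sub_mem ?_ (add_mem (Dt_mem_vanishOnSol hZ.1) (Dx_mem_vanishOnSol hZ.2))
  rw [mul_comm]
  exact vanishOnSol_mul waveExpr_mem _

theorem exists_current_of_conservedCurrent {c : DiffFun × DiffFun} (hc : c ∈ ConservedCurrent) :
    ∃ F G, c - current (F, G) ∈ TrivialCurrent := by
  obtain ⟨P, Q⟩ := c
  obtain ⟨F, G, H, hA, hB⟩ := exists_reduced_form ((mem_conservedCurrent P Q).1 hc)
  -- On solutions `P = (A - B)/2` and `Q = (A + B)/2`, so `H` contributes `(D_x (H/2), -D_t (H/2))`.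
  set K : DiffFun := (1 / 2 : ℝ) • subst sigma H with hK
  have hRK : restrict K = (1 / 2 : ℝ) • H := by rw [hK, map_smul, restrict_subst_sigma]
  have hP : restrict P = (1 / 2 : ℝ) • (restrict (P + Q) - restrict (Q - P)) := by
    rw [← map_sub, show P + Q - (Q - P) = (2 : ℝ) • P by rw [two_smul]; abel, map_smul, smul_smul]
    norm_num
  have hQ : restrict Q = (1 / 2 : ℝ) • (restrict (P + Q) + restrict (Q - P)) := by
    rw [← map_add, show P + Q + (Q - P) = (2 : ℝ) • Q by rw [two_smul]; abel, map_smul, smul_smul]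
    norm_num
  refine ⟨(1 / 2 : ℝ) • F, (1 / 2 : ℝ) • G, ?_⟩
  have h : (P, Q) - current ((1 / 2 : ℝ) • F, (1 / 2 : ℝ) • G) - (Dx K, -Dt K) ∈
      TrivialCurrent := by
    rw [current_apply, Prod.mk_sub_mk, Prod.mk_sub_mk]
    refine mem_trivialCurrent_of_vanish ?_ ?_
    · rw [mem_vanishOnSol]
      simp only [map_sub, map_smul, restrict_Dx, restrict_evalEta, restrict_evalXi, hRK]
      rw [hP, hA, hB, LinearMap.add_apply]
      module
    · rw [mem_vanishOnSol]
      simp only [map_sub, map_add, map_neg, map_smul, restrict_Dt, restrict_evalEta,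
        restrict_evalXi, hRK]
      rw [hQ, hA, hB, LinearMap.sub_apply]
      module
  simpa using add_mem h (curl_mem_trivialCurrent K)

/-- The isomorphism induced by an inclusion of submodules. -/
theorem exists_equiv_of_le {M : Type} [AddCommGroup M] [Module ℝ M] {A B T : Submodule ℝ M}
    (h : A ≤ B) (hs : ∀ b ∈ B, ∃ a ∈ A, b - a ∈ T) :
    ∃ e : (A ⧸ (A ⊓ T).submoduleOf A) ≃ₗ[ℝ] (B ⧸ T.submoduleOf B),
      ∀ a : A, e (Submodule.Quotient.mk a) = Submodule.Quotient.mk (⟨a.1, h a.2⟩ : B) := by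
  have hle : (A ⊓ T).submoduleOf A ≤ (T.submoduleOf B).comap (Submodule.inclusion h) :=
    fun a ha => ha.2
  let f := Submodule.mapQ _ _ (Submodule.inclusion h) hle
  refine ⟨LinearEquiv.ofBijective f ⟨?_, ?_⟩, fun a => rfl⟩
  · rw [injective_iff_map_eq_zero]
    intro x hx
    obtain ⟨a, rfl⟩ := Submodule.Quotient.mk_surjective _ x
    have h1 : Submodule.inclusion h a ∈ T.submoduleOf B :=
      (Submodule.Quotient.mk_eq_zero _).1 hx
    exact (Submodule.Quotient.mk_eq_zero _).2 ⟨a.2, h1⟩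
  · intro y
    obtain ⟨b, rfl⟩ := Submodule.Quotient.mk_surjective _ y
    obtain ⟨a, ha, hb⟩ := hs b.1 b.2
    refine ⟨Submodule.Quotient.mk ⟨a, ha⟩, ?_⟩
    refine ((Submodule.Quotient.eq _).2 ?_).symm
    exact hb

/-! ### The trivial currents of the special form -/

theorem characteristicOf_eq_subst_sigma (F G : LineFun) :
    characteristicOf (F, G) =
      subst sigma (-(subst etaIncl (lineEuler F) + subst xiIncl (lineEuler G))) := by
  rw [characteristicOf_apply, evalEta_eq_subst_sigma, evalXi_eq_subst_sigma, map_neg, map_add]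

theorem characteristicOf_eq_zero_of_mem {F G : LineFun}
    (h : characteristicOf (F, G) ∈ VanishOnSol) : characteristicOf (F, G) = 0 := by
  rw [mem_vanishOnSol, characteristicOf_eq_subst_sigma, restrict_subst_sigma] at h
  rw [characteristicOf_eq_subst_sigma, h, map_zero]

theorem subst_zero_eq_algebraMap {κ ι : Type} (f : SmoothFun κ) :
    subst (0 : κ → SmoothFun ι) f = algebraMap ℝ _ (eval 0 f) := rfl

theorem subst_etaProj_etaIncl (F : LineFun) : subst etaProj (subst etaIncl F) = F := by
  rw [subst_subst]
  conv_rhs => rw [← subst_id F]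
  congr 2
  funext c
  cases c <;> rfl

theorem subst_etaProj_xiIncl (F : LineFun) :
    subst etaProj (subst xiIncl F) = algebraMap ℝ _ (eval 0 F) := by
  rw [subst_subst, ← subst_zero_eq_algebraMap]
  congr 2
  funext c
  cases c <;> rfl

theorem subst_xiProj_xiIncl (F : LineFun) : subst xiProj (subst xiIncl F) = F := by
  rw [subst_subst]
  conv_rhs => rw [← subst_id F]
  congr 2
  funext c
  cases c <;> rfl

/-- Separation of variables: setting `ξ` and the `b k` to zero turns the Euler expression of `G`
into a constant, so that of `F` is constant, and then so is that of `G`. -/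
theorem exists_eq_of_characteristicOf_mem {F G : LineFun}
    (h : characteristicOf (F, G) ∈ VanishOnSol) : ∃ (f g : LineFun) (r : ℝ),
      F = lineD f + r • coord (.v 0) ∧ G = lineD g - r • coord (.v 0) := by
  rw [mem_vanishOnSol, characteristicOf_eq_subst_sigma, restrict_subst_sigma, neg_eq_zero] at h
  have h1 := congrArg (subst etaProj) h
  rw [map_add, subst_etaProj_etaIncl, subst_etaProj_xiIncl, map_zero, add_eq_zero_iff_eq_neg,
    ← map_neg] at h1
  have h2 := congrArg (subst xiProj) h
  rw [h1, map_add, subst_xiProj_xiIncl, subst_algebraMap, subst_algebraMap, map_zero,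
    add_comm, add_eq_zero_iff_eq_neg, ← map_neg] at h2
  obtain ⟨f, hf⟩ := exists_lineD_add_of_lineEuler_eq_const h1
  obtain ⟨g, hg⟩ := exists_lineD_add_of_lineEuler_eq_const h2
  exact ⟨f, g, _, hf, hg.trans (by rw [neg_smul, sub_eq_add_neg])⟩

theorem evalEta_v_zero : evalEta (coord (.v 0)) = u 0 1 - u 1 0 := rfl

theorem evalXi_v_zero : evalXi (coord (.v 0)) = u 0 1 + u 1 0 := rfl

theorem current_lineD_add (f g : LineFun) (r : ℝ) :
    current (lineD f + r • coord (.v 0), lineD g - r • coord (.v 0)) =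
      (evalEta (lineD f) - evalXi (lineD g) + (2 * r) • u 0 1,
        evalEta (lineD f) + evalXi (lineD g) - (2 * r) • u 1 0) := by
  rw [current_apply]
  simp only [map_add, map_sub, map_smul, evalEta_v_zero, evalXi_v_zero]
  congr 1 <;> module

theorem restrict_Dt_evalEta (F : LineFun) :
    restrict (Dt (evalEta F)) = -subst etaIncl (lineD F) := by
  rw [restrict_Dt, restrict_evalEta, LinearMap.sub_apply, DXi_subst_etaIncl, DEta_subst_etaIncl,
    zero_sub]

theorem restrict_Dt_evalXi (G : LineFun) :
    restrict (Dt (evalXi G)) = subst xiIncl (lineD G) := by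
  rw [restrict_Dt, restrict_evalXi, LinearMap.sub_apply, DXi_subst_xiIncl, DEta_subst_xiIncl,
    sub_zero]

theorem current_lineD_add_mem_trivialCurrent (f g : LineFun) (r : ℝ) :
    current (lineD f + r • coord (.v 0), lineD g - r • coord (.v 0)) ∈ TrivialCurrent := by
  rw [current_lineD_add]
  -- `D_x K` is the first component identically, whereas `-D_t K` agrees with the second only on
  -- solutions.
  set K : DiffFun := evalEta f - evalXi g + (2 * r) • u 0 0 with hK
  have h1 : (evalEta (lineD f) - evalXi (lineD g) + (2 * r) • u 0 1,
      evalEta (lineD f) + evalXi (lineD g) - (2 * r) • u 1 0) - (Dx K, -Dt K) ∈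
        TrivialCurrent := by
    refine mem_trivialCurrent_of_vanish ?_ ?_
    · simp [hK, Dx_evalEta, Dx_evalXi]
    · rw [mem_vanishOnSol]
      simp only [hK, map_add, map_sub, map_smul, map_neg, restrict_Dt_evalEta,
        restrict_Dt_evalXi, restrict_evalEta, restrict_evalXi, Dt_u]
      module
  simpa using add_mem h1 (curl_mem_trivialCurrent K)

theorem mem_V₀_iff {c : DiffFun × DiffFun} : c ∈ V₀ ↔ ∃ (F G : LineFun) (C : ℝ),
    c = (evalEta (lineD F) - evalXi (lineD G) + C • u 0 1,
      evalEta (lineD F) + evalXi (lineD G) - C • u 1 0) := by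
  constructor
  · rintro ⟨⟨⟨F, G⟩, rfl⟩, hc⟩
    obtain ⟨c, h1, h2⟩ := exists_current_with_characteristic F G
    obtain ⟨f, g, r, rfl, rfl⟩ := exists_eq_of_characteristicOf_mem
      (mem_vanishOnSol_of_trivialCurrent (by simpa using add_mem h1 hc) h2)
    exact ⟨f, g, 2 * r, current_lineD_add f g r⟩
  · rintro ⟨F, G, C, rfl⟩
    have h1 := current_lineD_add F G (C / 2)
    rw [mul_div_cancel₀ C two_ne_zero] at h1
    rw [← h1]
    exact ⟨⟨_, rfl⟩, current_lineD_add_mem_trivialCurrent F G (C / 2)⟩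

/-! ### Variational symmetries -/

/-- The first variation `-u_t D_t μ + u_x D_x μ`, integrated by parts. -/
theorem prolong_lagrangian (μ : DiffFun) :
    prolong lagrangian μ = Div (-(u 1 0 * μ), u 0 1 * μ) + μ * waveExpr := by
  have h : prolong lagrangian μ = -(u 1 0 * Dt μ) + u 0 1 * Dx μ := by
    change vectorField _ lagrangian = _
    rw [lagrangian, map_smul, map_sub, pow_two, pow_two, vectorField_mul, vectorField_mul, u, u,
      vectorField_coord, vectorField_coord]
    simp only [pow_one, pow_zero, Module.End.one_apply]
    rw [mul_comm (Dt μ), mul_comm (Dx μ)]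
    module
  rw [h, Div_apply, map_neg, Dt_mul, Dx_mul, Dt_u, Dx_u, waveExpr]
  ring

theorem variationalSymmetry_eq : VariationalSymmetry = Characteristic := by
  ext μ
  change prolong lagrangian μ ∈ LinearMap.range Div ↔ μ * waveExpr ∈ LinearMap.range Div
  rw [prolong_lagrangian]
  exact Submodule.add_mem_iff_right _ ⟨_, rfl⟩

theorem characteristicForm_le : CharacteristicForm ≤ VariationalSymmetry := by
  rw [variationalSymmetry_eq]
  rintro _ ⟨⟨F, G⟩, rfl⟩
  obtain ⟨c, _, h⟩ := exists_current_with_characteristic F G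
  exact ⟨c, h⟩

theorem exists_characteristicForm_sub_mem {μ : DiffFun} (hμ : μ ∈ VariationalSymmetry) :
    ∃ ν ∈ CharacteristicForm, μ - ν ∈ VanishOnSol := by
  rw [variationalSymmetry_eq] at hμ
  obtain ⟨c, hc⟩ := hμ
  have hc' : Div c = μ * waveExpr := hc
  obtain ⟨F, G, h1⟩ := exists_current_of_conservedCurrent (c := c) (by
    change Div c ∈ VanishOnSol
    rw [hc', mul_comm]
    exact vanishOnSol_mul waveExpr_mem _)
  obtain ⟨d, h2, h3⟩ := exists_current_with_characteristic F G
  refine ⟨characteristicOf (F, G), ⟨_, rfl⟩, ?_⟩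
  -- Both currents represent the same conservation law, so their difference is trivial and has
  -- characteristic `μ - ν`.
  refine mem_vanishOnSol_of_trivialCurrent (c := c - d) ?_ (by rw [map_sub, hc', h3, sub_mul])
  simpa using sub_mem h1 h2

theorem characteristicForm_inf_vanishOnSol : CharacteristicForm ⊓ VanishOnSol = ⊥ := by
  rw [eq_bot_iff]
  rintro _ ⟨⟨⟨F, G⟩, rfl⟩, h⟩
  exact characteristicOf_eq_zero_of_mem h

theorem exists_characteristicForm_equiv : ∃ e : CharacteristicForm ≃ₗ[ℝ]
    (VariationalSymmetry ⧸ VanishOnSol.submoduleOf VariationalSymmetry),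
      ∀ μ : CharacteristicForm, e μ =
        Submodule.Quotient.mk (⟨μ.1, characteristicForm_le μ.2⟩ : VariationalSymmetry) := by
  obtain ⟨e, he⟩ := exists_equiv_of_le characteristicForm_le
    fun μ hμ => exists_characteristicForm_sub_mem hμ
  have h : (CharacteristicForm ⊓ VanishOnSol).submoduleOf CharacteristicForm = ⊥ := by
    rw [characteristicForm_inf_vanishOnSol, Submodule.submoduleOf, Submodule.comap_bot,
      Submodule.ker_subtype]
  exact ⟨(Submodule.quotEquivOfEqBot _ h).symm.trans e, fun μ => he μ⟩

end WaveCL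

end

theorem mainTheorem2 :
    -- `V` consists of conserved currents, and its inclusion induces an isomorphism of `V ⧸ V₀`
    -- onto the space of conservation laws
    (∃ hV : WaveCL.V ≤ WaveCL.ConservedCurrent,
      ∃ e : (WaveCL.V ⧸ WaveCL.V₀.submoduleOf WaveCL.V) ≃ₗ[ℝ] WaveCL.ConservationLaw,
        ∀ c : WaveCL.V, e (Submodule.Quotient.mk c) =
          Submodule.Quotient.mk (⟨c.1, hV c.2⟩ : WaveCL.ConservedCurrent)) ∧
    -- the explicit description of `V₀`
    ((WaveCL.V₀ : Set (WaveCL.DiffFun × WaveCL.DiffFun)) =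
      {c | ∃ (F G : WaveCL.LineFun) (C : ℝ),
        c = (WaveCL.evalEta (WaveCL.lineD F) - WaveCL.evalXi (WaveCL.lineD G) + C • WaveCL.u 0 1,
          WaveCL.evalEta (WaveCL.lineD F) + WaveCL.evalXi (WaveCL.lineD G)
            - C • WaveCL.u 1 0)}) ∧
    -- variational symmetries are the same as conservation-law characteristics
    WaveCL.VariationalSymmetry = WaveCL.Characteristic ∧
    -- the functions `μ` of the explicit form are variational symmetries, and their inclusion
    -- induces an isomorphism onto the quotient space of variational symmetries
    (∃ hM : WaveCL.CharacteristicForm ≤ WaveCL.VariationalSymmetry,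
      ∃ e : WaveCL.CharacteristicForm ≃ₗ[ℝ]
          (WaveCL.VariationalSymmetry ⧸ WaveCL.VanishOnSol.submoduleOf WaveCL.VariationalSymmetry),
        ∀ μ : WaveCL.CharacteristicForm, e μ =
          Submodule.Quotient.mk (⟨μ.1, hM μ.2⟩ : WaveCL.VariationalSymmetry)) ∧
    -- `μ` is a characteristic of the conservation law containing `(F - G, F + G)`
    (∀ F G : WaveCL.LineFun, ∃ c : WaveCL.DiffFun × WaveCL.DiffFun,
      c - WaveCL.current (F, G) ∈ WaveCL.TrivialCurrent ∧
      WaveCL.Div c = WaveCL.characteristicOf (F, G) * WaveCL.waveExpr) := by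
  exact ⟨⟨WaveCL.V_le_conservedCurrent,
      WaveCL.exists_equiv_of_le WaveCL.V_le_conservedCurrent fun c hc =>
        let ⟨F, G, h⟩ := WaveCL.exists_current_of_conservedCurrent hc
        ⟨WaveCL.current (F, G), ⟨_, rfl⟩, h⟩⟩,
    Set.ext fun _ => WaveCL.mem_V₀_iff, WaveCL.variationalSymmetry_eq,
    ⟨WaveCL.characteristicForm_le, WaveCL.exists_characteristicForm_equiv⟩,
    WaveCL.exists_current_with_characteristic⟩
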